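/- Conventions. Let $n\ge 7$. A homotopy $n$-sphere is a closed smooth $n$-manifold homotopy equivalent to $S^n$; $D^p\subset\mathbb R^p$ is the closed unit ball. *Special generic maps.* A smooth map $f\colon M^n\to\mathbb R^p$ ($n\ge p\ge 1$) is special generic if each of its singular points (points where the differential is not onto) is a definite fold point, i.e. in suitable smooth local coordinates at $x$ and $f(x)$ the map $f$ has the form $(x_1,\dots,x_n)\mapsto(x_1,\dots,x_{p-1},\pm(x_p^2+\dots+x_n^2))$. For $p=1$ it is called a special generic function. *Fold perfection.* For $f\colon M\to\mathbb R^p$ let $W_f$ be the quotient of $M$ (with quotient map $q_f$) that identifies two points if they lie in the same connected component of a fibre of $f$. If $f$ is special generic and $p<n$, then $W_f$ is a smooth $p$-manifold with boundary, with the unique smooth structure for which $q_f$ is smooth, $q_f^{-1}(\partial W_f)$ is the singular set of $f$, and the induced map $W_f\to\mathbb R^p$ is an immersion. A special generic map $f\colon\Sigma^n\to\mathbb R^p$ ($p<n$) is standard if $W_f$ is diffeomorphic to $D^p$. The fold perfection of $\Sigma^n$ is the greatest integer $p\ge1$ for which there is a standard special generic map $\Sigma^n\to\mathbb R^p$. *Morse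 perfection.* The Morse perfection of $\Sigma^n$ is the greatest integer $k\ge-1$ for which there is a smooth map $\eta\colon S^k\times\Sigma^n\to\mathbb R$ such that $\eta_s=\eta(s,\cdot)$ is a special generic function and $\eta_{-s}=-\eta_s$ for all $s\in S^k$ (where $S^{-1}=\emptyset$). *Gromoll filtration.* For a diffeomorphism $g$ of $D^{n-1}$ that is the identity near the boundary, let $\varphi_g$ be the diffeomorphism of $S^{n-1}$ that is given by $g$ on the hemisphere $\{(-\sqrt{1-\|x\|^2},x)\,:\,x\in D^{n-1}\}$ and by the identity on the opposite hemisphere, and let $\Sigma_g$ be the homotopy $n$-sphere obtained by gluing two copies of $D^n$ along their boundaries via $\varphi_g$. The Gromoll filtration of $\Sigma^n$ is the greatest $q\in\{1,\dots,n-1\}$ such that $\Sigma^n$ is diffeomorphic to $\Sigma_g$ for some $g$ that preserves the last $q-1$ coordinates of every point of $D^{n-1}$. **Theorem.** Let $\Sigma^n$ be a homotopy sphere of dimension $n\ge7$. Then 1. $(\text{Gromoll filtration of }\Sigma^n)\le(\text{fold perfection of }\Sigma^n)$, and 2. $(\text{fold perfection of }\Sigma^n)-1\le(\text{Morse perfection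 of }\Sigma^n)$. -/

import Mathlib

open scoped Manifold ContDiff

noncomputable section

namespace FoldPerfection

/-- Euclidean space `ℝ^p`. -/
abbrev E (p : ℕ) : Type := EuclideanSpace ℝ (Fin p)

/-- The standard sphere `S^k ⊂ ℝ^(k+1)`. -/
abbrev S (k : ℕ) : Type := Metric.sphere (0 : E (k + 1)) 1

/-! ### Special generic maps -/

section SpecialGeneric

variable (n : ℕ) {p : ℕ} {M : Type*} [TopologicalSpace M] [ChartedSpace (E n) M]

/-- `x` is a singular point of `f : M^n → ℝ^p`: the differential at `x` is not onto. -/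
def IsSingularPoint (f : M → E p) (x : M) : Prop :=
  ¬ Function.Surjective (mfderiv (𝓡 n) (𝓡 p) f x)

/-- `x` is a fold point of `f : M^n → ℝ^p` with `l` positive squares: in smooth coordinates
`x_1, …, x_n` centred at `x` and `y_1, …, y_p` around `f x` the map `f` is given by
`y_i = x_i` for `i < p` and
`y_p = x_p^2 + … + x_(p+l-1)^2 - x_(p+l)^2 - … - x_n^2`.
(The coordinate `x_(j+1)` is the entry with index `j : Fin n`.) -/
def IsFoldPointWith (l : ℕ) (f : M → E p) (x : M) : Prop :=
  ∃ φ ∈ IsManifold.maximalAtlas (𝓡 n) ∞ M, ∃ ψ ∈ IsManifold.maximalAtlas (𝓡 p) ∞ (E p),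
    x ∈ φ.source ∧ φ x = 0 ∧ Set.MapsTo f φ.source ψ.source ∧
    ∀ z ∈ φ.source,
      (∀ (i : Fin p) (j : Fin n), (i : ℕ) = j → (i : ℕ) + 1 < p → ψ (f z) i = φ z j) ∧
      (∀ i : Fin p, (i : ℕ) + 1 = p → ψ (f z) i =
        ∑ j : Fin n, if (j : ℕ) + 1 < p then 0
          else if (j : ℕ) + 1 < p + l then (φ z j) ^ 2 else -(φ z j) ^ 2)

/-- A definite fold point: a fold point whose absolute index `max (l, n - p + 1 - l)`
equals `n - p + 1`. -/
def IsDefiniteFoldPoint (f : M → E p) (x : M) : Prop :=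
  ∃ l : ℕ, l ≤ n - p + 1 ∧ max l (n - p + 1 - l) = n - p + 1 ∧ IsFoldPointWith n l f x

/-- A special generic map `f : M^n → ℝ^p`, `n ≥ p ≥ 1`. -/
structure IsSpecialGeneric (f : M → E p) : Prop where
  one_le : 1 ≤ p
  le_dim : p ≤ n
  smooth : ContMDiff (𝓡 n) (𝓡 p) ∞ f
  definite : ∀ x, IsSingularPoint n f x → IsDefiniteFoldPoint n f x

/-- A special generic function `M → ℝ`, with `ℝ` regarded as `ℝ^1`. -/
def IsSpecialGenericFunction (h : M → ℝ) : Prop :=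
  IsSpecialGeneric n (fun x => (!₂[h x] : E 1))

end SpecialGeneric

/-! ### Stein factorization -/

section Stein

variable {X Y : Type*} [TopologicalSpace X]

/-- Two points are equivalent if they have the same image `y` and lie in the same connected
component of the fibre over `y`. -/
def steinSetoid (f : X → Y) : Setoid X where
  r x₁ x₂ := f x₁ = f x₂ ∧ x₂ ∈ connectedComponentIn (f ⁻¹' {f x₁}) x₁
  iseqv :=
    { refl := fun _ => ⟨rfl, mem_connectedComponentIn rfl⟩
      symm := fun {x y} h => ⟨h.1.symm, by
        rw [← h.1, ← connectedComponentIn_eq h.2]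
        exact mem_connectedComponentIn rfl⟩
      trans := fun {x y z} h₁ h₂ => ⟨h₁.1.trans h₂.1, by
        rw [connectedComponentIn_eq h₁.2, h₁.1]
        exact h₂.2⟩ }

/-- The space `W_f = X / ∼_f`, with the quotient topology. -/
abbrev SteinSpace (f : X → Y) : Type _ := Quotient (steinSetoid f)

/-- The quotient map `q_f : X → W_f`. -/
def steinQuot (f : X → Y) (x : X) : SteinSpace f := Quotient.mk (steinSetoid f) x

/-- The induced map `W_f → Y`. -/
def steinMap (f : X → Y) : SteinSpace f → Y :=
  Quotient.lift f (fun _ _ h => h.1)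

end Stein

/-! ### Standard special generic maps and fold perfection -/

section Fold

variable (n : ℕ) {p : ℕ} {M : Type*} [TopologicalSpace M] [ChartedSpace (E n) M]

/-- A standard special generic map `f : M^n → ℝ^p`, `p < n`: the Stein factorization `W_f` is
diffeomorphic to the closed unit ball `D^p`.

The smooth structure of `W_f` is the (unique) structure of a smooth `p`-manifold with boundary for
which `q_f` is smooth, the preimage of the boundary under `q_f` is the singular locus, and the
induced map `W_f → ℝ^p` is an immersion. Hence a diffeomorphism `W_f ≅ D^p` is a homeomorphism `ι`
that carries this structure to the one of `D^p`, which is what the three conditions on `ι` say.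
A map on `D^p` is smooth if it is the restriction of a smooth map on `ℝ^p`. -/
def IsStandardSpecialGeneric (f : M → E p) : Prop :=
  IsSpecialGeneric n f ∧ p < n ∧
  ∃ ι : SteinSpace f ≃ₜ Metric.closedBall (0 : E p) 1,
    ContMDiff (𝓡 n) (𝓡 p) ∞ (fun x => (ι (steinQuot f x) : E p)) ∧
    (∀ x, ‖(ι (steinQuot f x) : E p)‖ = 1 ↔ IsSingularPoint n f x) ∧
    ∃ F : E p → E p, ContDiff ℝ ∞ F ∧
      (∀ y ∈ Metric.closedBall (0 : E p) 1, Function.Injective (fderiv ℝ F y)) ∧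
      ∀ w, F (ι w) = steinMap f w

variable (M) in
/-- The greatest `p ≥ 1` for which there is a standard special generic map `M^n → ℝ^p`. The set is
bounded because such maps have `p < n` (and the value is `0` if there is no such map at all). -/
def foldPerfection : ℕ :=
  sSup {p : ℕ | 1 ≤ p ∧ ∃ f : M → E p, IsStandardSpecialGeneric n f}

end Fold

/-! ### Morse perfection -/

section Morse

variable (n : ℕ) (M : Type*) [TopologicalSpace M] [ChartedSpace (E n) M]

/-- There is a smooth odd family of special generic functions on `M` parametrized by `S^k`. -/
def HasMorseFamily (k : ℕ) : Prop :=
  ∃ η : S k × M → ℝ, ContMDiff ((𝓡 k).prod (𝓡 n)) 𝓘(ℝ, ℝ) ∞ η ∧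
    (∀ s, IsSpecialGenericFunction n (fun x => η (s, x))) ∧
    ∀ s x, η (-s, x) = -η (s, x)

/-- The greatest integer `k ≥ -1` for which there is a smooth odd family of special generic
functions on `M` parametrized by `S^k`; as `S^(-1)` is empty, `k = -1` is always admissible.
The supremum is taken in `ℤ ∪ {∞}`. -/
def morsePerfection : WithTop ℤ :=
  sSup {a : WithTop ℤ | a = ((-1 : ℤ) : WithTop ℤ) ∨
    ∃ k : ℕ, HasMorseFamily n M k ∧ a = ((k : ℤ) : WithTop ℤ)}

end Morse

/-! ### Twisted spheres and the Gromoll filtration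

Here `m = n - 1`, so that the homotopy spheres have dimension `n = m + 1`. -/

section Gromoll

/-- The point `(√(1 - t²) z, t)` of `S^(m+1)`, for `z ∈ S^m` and `t ∈ [-1, 1]`. -/
def cyl {m : ℕ} (z : S m) (t : Set.Icc (-1 : ℝ) 1) : S (m + 1) :=
  ⟨WithLp.toLp 2 (Fin.snoc (α := fun _ => ℝ)
      (fun i => √(1 - (t : ℝ) ^ 2) * (z : E (m + 1)) i) (t : ℝ)), by
    have ht : 0 ≤ 1 - (t : ℝ) ^ 2 := by nlinarith [t.2.1, t.2.2]
    have hz : ∑ i, ((z : E (m + 1)) i) ^ 2 = 1 := by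
      rw [← EuclideanSpace.real_norm_sq_eq, mem_sphere_zero_iff_norm.1 z.2, one_pow]
    rw [mem_sphere_zero_iff_norm, ← sq_eq_sq₀ (norm_nonneg _) zero_le_one,
      EuclideanSpace.real_norm_sq_eq, Fin.sum_univ_castSucc]
    simp only [Fin.snoc_castSucc, Fin.snoc_last, mul_pow, Real.sq_sqrt ht, ← Finset.mul_sum, hz]
    ring⟩

/-- The vector `(ε √(1 - ‖x‖²), x)`; for `ε = ±1` and `x ∈ D^m` it lies on `S^m`, and this is the
embedding `ι_± : D^m → S^m` onto a hemisphere. -/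
def hemi {m : ℕ} (ε : ℝ) (x : E m) : E (m + 1) :=
  WithLp.toLp 2 (Fin.cons (α := fun _ => ℝ) (ε * √(1 - ‖x‖ ^ 2)) (fun i => x i))

/-- `g ∈ Diff(D^m, ∂)`: a diffeomorphism of `D^m` that is the identity near the boundary, extended
by the identity to `ℝ^m`. -/
def IsDiscDiffeo {m : ℕ} (g : E m ≃ₘ^∞⟮𝓡 m, 𝓡 m⟯ E m) : Prop :=
  ∃ r < 1, ∀ x, r ≤ ‖x‖ → g x = x

/-- `φ = φ_g`, the diffeomorphism of `S^m` determined by `φ ∘ ι_- = ι_- ∘ g` and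
`φ ∘ ι_+ = ι_+`. -/
def IsSphereExtension {m : ℕ} (g : E m ≃ₘ^∞⟮𝓡 m, 𝓡 m⟯ E m) (φ : S m ≃ₘ^∞⟮𝓡 m, 𝓡 m⟯ S m) : Prop :=
  ∀ x : E m, ‖x‖ ≤ 1 → ∀ z : S m,
    ((z : E (m + 1)) = hemi (-1) x → (φ z : E (m + 1)) = hemi (-1) (g x)) ∧
    ((z : E (m + 1)) = hemi 1 x → φ z = z)

/-- `M` is diffeomorphic to the twisted sphere obtained from two balls of dimension `m + 1` by
identifying their boundaries via the diffeomorphism `φ` of `S^m`. The smooth structure is given by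
gluing the open balls `V_- = S^(m+1) ∖ {(0, …, 0, 1)}` and `V_+ = S^(m+1) ∖ {(0, …, 0, -1)}` along
the open cylinder `S^m × (-1, 1)`, embedded in both by `cyl`, via `φ × id`:
`M` is the union of the images of open smooth embeddings `k_±` of `V_±` that meet exactly in the
image of the cylinder and satisfy `k_- (z, t) = k_+ (φ z, t)`. -/
def IsTwistedSphere {m : ℕ} (φ : S m ≃ₘ^∞⟮𝓡 m, 𝓡 m⟯ S m)
    (M : Type*) [TopologicalSpace M] [ChartedSpace (E (m + 1)) M] : Prop :=
  ∃ kminus kplus : OpenPartialHomeomorph (S (m + 1)) M,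
    kminus.source = {v : S (m + 1) | (v : E (m + 2)) (Fin.last (m + 1)) ≠ 1} ∧
    kplus.source = {v : S (m + 1) | (v : E (m + 2)) (Fin.last (m + 1)) ≠ -1} ∧
    ContMDiffOn (𝓡 (m + 1)) (𝓡 (m + 1)) ∞ kminus kminus.source ∧
    ContMDiffOn (𝓡 (m + 1)) (𝓡 (m + 1)) ∞ kminus.symm kminus.target ∧
    ContMDiffOn (𝓡 (m + 1)) (𝓡 (m + 1)) ∞ kplus kplus.source ∧
    ContMDiffOn (𝓡 (m + 1)) (𝓡 (m + 1)) ∞ kplus.symm kplus.target ∧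
    kminus.target ∪ kplus.target = Set.univ ∧
    kminus.target ∩ kplus.target = kminus '' (kminus.source ∩ kplus.source) ∧
    ∀ (z : S m) (t : Set.Icc (-1 : ℝ) 1), (t : ℝ) ∈ Set.Ioo (-1 : ℝ) 1 →
      kminus (cyl z t) = kplus (cyl (φ z) t)

variable (m : ℕ) (M : Type*) [TopologicalSpace M] [ChartedSpace (E (m + 1)) M]

/-- The class of `M` in `Θ_n`, `n = m + 1`, is of the form `Σ(γ)` with `γ ∈ Γ^n_q`, `q ≥ 1`:
for some `g ∈ Diff(D^(n-1), ∂)` that preserves the last `q - 1` coordinates, `M` is diffeomorphic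
to the twisted sphere of `φ_g`. (`Γ^n_q` consists of the isotopy classes of such `g`, and `Σ` sends
the class of `g` to the class of the twisted sphere. Reversing the orientation of `M` amounts to
replacing `g` by its inverse, so orientations play no role.) -/
def IsInGromollGroup (q : ℕ) : Prop :=
  ∃ (g : E m ≃ₘ^∞⟮𝓡 m, 𝓡 m⟯ E m) (φ : S m ≃ₘ^∞⟮𝓡 m, 𝓡 m⟯ S m),
    IsDiscDiffeo g ∧
    (∀ x : E m, ‖x‖ ≤ 1 → ∀ i : Fin m, m - (q - 1) ≤ (i : ℕ) → g x i = x i) ∧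
    IsSphereExtension g φ ∧ IsTwistedSphere φ M

/-- The Gromoll filtration of `M`, of dimension `n = m + 1`: the greatest `q ∈ {1, …, n - 1}` for
which the class of `M` lies in `Γ^n_q` (so it is `n - 1` for the standard sphere). -/
def gromollFiltration : ℕ :=
  sSup {q : ℕ | 1 ≤ q ∧ q ≤ m ∧ IsInGromollGroup m M q}

end Gromoll

end FoldPerfection

end

/-!
The projection of `S^n ⊂ ℝ^k × ℝ^q` to `ℝ^q` is a standard special generic map, and all fold
behaviour can be reduced to it. Let `f` be a smooth map into the closed unit ball whose singular
points are exactly the points over the unit sphere. At a definite fold point `1 - ‖f‖²` is the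
square of the norm of a smooth `ℝ^k`-valued map `y`, and `(f, y)` is a local diffeomorphism to
`S^n`: near the point, `f` is the projection of a piece of the sphere.

Composing with the diffeomorphism `W_f ≅ D^p`, a standard special generic map becomes such an `f`.
The height functions `x ↦ ⟪s, f x⟫`, `s ∈ S^(p-1)`, are singular only where `f x = ±s`, and there
they are height functions of the sphere, so they form an odd family of special generic functions.

If the gluing diffeomorphism of a twisted sphere preserves the last `q - 1` coordinates, the
projections of the two punctured spheres to the last `q` coordinates fit together. Each fibre of
the resulting map lies in one of the two punctured spheres, hence the map is standard.
-/

namespace FoldPerfection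

open Set Filter Topology Module

noncomputable section

section Hadamard

universe u

variable {H F : Type u} [NormedAddCommGroup H] [NormedSpace ℝ H] [FiniteDimensional ℝ H]
  [NormedAddCommGroup F] [NormedSpace ℝ F]

theorem hasFDerivAt_integral_param {f : H × ℝ → F} (hf : ContDiff ℝ 1 f) (x₀ : H) :
    HasFDerivAt (fun x => ∫ t in (0 : ℝ)..1, f (x, t))
      (∫ t in (0 : ℝ)..1, fderiv ℝ f (x₀, t) ∘L ContinuousLinearMap.inl ℝ H ℝ) x₀ := by
  have hf' : Continuous fun z : H × ℝ => fderiv ℝ f z ∘L ContinuousLinearMap.inl ℝ H ℝ :=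
    (hf.continuous_fderiv one_ne_zero).clm_comp continuous_const
  have : ProperSpace H := FiniteDimensional.proper ℝ H
  obtain ⟨C, hC⟩ := ((isCompact_closedBall x₀ 1).prod (isCompact_Icc (a := (0 : ℝ)) (b := 1)))
    |>.exists_bound_of_continuousOn hf'.continuousOn
  refine intervalIntegral.hasFDerivAt_integral_of_dominated_of_fderiv_le
    (F' := fun x t => fderiv ℝ f (x, t) ∘L ContinuousLinearMap.inl ℝ H ℝ)
    (bound := fun _ => C) (Metric.ball_mem_nhds x₀ one_pos) (.of_forall fun x => ?_) ?_ ?_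
    (.of_forall fun t ht x hx => hC (x, t) ⟨Metric.ball_subset_closedBall hx, ?_⟩)
    intervalIntegrable_const (.of_forall fun t _ x _ => ?_)
  · exact (hf.continuous.comp (by fun_prop : Continuous (x, ·))).aestronglyMeasurable
  · exact (hf.continuous.comp (by fun_prop : Continuous (x₀, ·))).intervalIntegrable _ _
  · exact (hf'.comp (by fun_prop : Continuous (x₀, ·))).aestronglyMeasurable
  · rw [uIoc_of_le zero_le_one] at ht
    exact Ioc_subset_Icc_self ht
  · exact (hf.differentiable one_ne_zero (x, t)).hasFDerivAt.comp x (hasFDerivAt_prodMk_left x t)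

theorem contDiff_nat_integral_param (k : ℕ) : ∀ {F : Type u} [NormedAddCommGroup F]
    [NormedSpace ℝ F] {f : H × ℝ → F}, ContDiff ℝ ∞ f →
    ContDiff ℝ k (fun x => ∫ t in (0 : ℝ)..1, f (x, t)) := by
  induction k with
  | zero =>
    intro F _ _ f hf
    exact contDiff_zero.2 (continuous_iff_continuousAt.2 fun x =>
      (hasFDerivAt_integral_param (hf.of_le (by norm_cast)) x).continuousAt)
  | succ k ih =>
    intro F _ _ f hf
    push_cast
    refine contDiff_succ_iff_hasFDerivAt.2 ⟨_, ih (f := fun z : H × ℝ =>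
      fderiv ℝ f z ∘L ContinuousLinearMap.inl ℝ H ℝ) ?_, fun x =>
      hasFDerivAt_integral_param (hf.of_le (by norm_cast)) x⟩
    exact (hf.fderiv_right (m := ∞) (by norm_cast)).clm_comp contDiff_const

theorem contDiff_integral_param {f : H × ℝ → F} (hf : ContDiff ℝ ∞ f) :
    ContDiff ℝ ∞ (fun x => ∫ t in (0 : ℝ)..1, f (x, t)) :=
  contDiff_infty.2 fun k => contDiff_nat_integral_param k hf

theorem exists_contDiff_sub_eq_smul [CompleteSpace F] {B : H → F} (hB : ContDiff ℝ ∞ B)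
    (ℓ : H →L[ℝ] ℝ) (e : H) :
    ∃ C : H → F, ContDiff ℝ ∞ C ∧ ∀ w, B w - B (w - ℓ w • e) = ℓ w • C w := by
  have hB' : ContDiff ℝ ∞ (fderiv ℝ B) := hB.fderiv_right (m := ∞) (by norm_cast)
  refine ⟨fun w => ∫ t in (0 : ℝ)..1, fderiv ℝ B (w - ℓ w • e + t • ℓ w • e) e, ?_, fun w => ?_⟩
  · refine contDiff_integral_param
      (f := fun z : H × ℝ => fderiv ℝ B (z.1 - ℓ z.1 • e + z.2 • ℓ z.1 • e) e) ?_
    have hsegment : ContDiff ℝ ∞ fun z : H × ℝ => z.1 - ℓ z.1 • e + z.2 • ℓ z.1 • e := by fun_prop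
    exact (hB'.comp hsegment).clm_apply contDiff_const
  · have hderiv (t : ℝ) : HasDerivAt (fun t : ℝ => B (w - ℓ w • e + t • ℓ w • e))
        (ℓ w • fderiv ℝ B (w - ℓ w • e + t • ℓ w • e) e) t := by
      have hsegment : HasDerivAt (fun t : ℝ => w - ℓ w • e + t • ℓ w • e) (ℓ w • e) t := by
        simpa only [id, one_smul] using
          ((hasDerivAt_id t).smul_const (ℓ w • e)).const_add (w - ℓ w • e)
      have hcomp := (hB.differentiable (by simp) _).hasFDerivAt.comp_hasDerivAt t hsegment
      rwa [map_smul] at hcomp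
    have hcont : Continuous fun t : ℝ => ℓ w • fderiv ℝ B (w - ℓ w • e + t • ℓ w • e) e := by
      have hsegment : Continuous fun t : ℝ => w - ℓ w • e + t • ℓ w • e := by fun_prop
      exact ((hB'.continuous.comp hsegment).clm_apply continuous_const).const_smul (ℓ w)
    have hint := intervalIntegral.integral_eq_sub_of_hasDerivAt (fun t _ => hderiv t)
      (hcont.intervalIntegrable 0 1)
    rw [intervalIntegral.integral_smul] at hint
    simpa using hint.symm

theorem exists_contDiff_eventuallyEq {B : H → F} {a : H} (hB : ∀ᶠ w in 𝓝 a, ContDiffAt ℝ ∞ B w) :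
    ∃ B' : H → F, ContDiff ℝ ∞ B' ∧ B' =ᶠ[𝓝 a] B := by
  obtain ⟨ε, hε, hball⟩ := Metric.eventually_nhds_iff_ball.1 hB
  let b : ContDiffBump a := ⟨ε / 4, ε / 2, by positivity, by linarith⟩
  refine ⟨fun w => b w • B w, contDiff_iff_contDiffAt.2 fun w => ?_, ?_⟩
  · by_cases hw : w ∈ Metric.ball a ε
    · exact b.contDiffAt.smul (hball w hw)
    · have hw' : w ∉ tsupport b := by
        rw [b.tsupport_eq]
        exact fun h => hw (Metric.closedBall_subset_ball (half_lt_self hε) h)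
      refine contDiffAt_const (c := (0 : F)) |>.congr_of_eventuallyEq ?_
      filter_upwards [notMem_tsupport_iff_eventuallyEq.1 hw'] with y hy
      rw [hy, Pi.zero_apply, zero_smul]
  · filter_upwards [b.eventuallyEq_one] with w hw
    rw [hw, Pi.one_apply, one_smul]

theorem exists_contDiff_eventually_eq_smul [CompleteSpace F] {B : H → F}
    (hB : ∀ᶠ w in 𝓝 0, ContDiffAt ℝ ∞ B w) {ℓ : H →L[ℝ] ℝ} (hℓ : ℓ ≠ 0)
    (hzero : ∀ᶠ w in 𝓝 0, ℓ w = 0 → B w = 0) :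
    ∃ C : H → F, ContDiff ℝ ∞ C ∧ ∀ᶠ w in 𝓝 0, B w = ℓ w • C w := by
  obtain ⟨e, he⟩ : ∃ e, ℓ e = 1 :=
    LinearMap.surjective_of_ne_zero (f := (ℓ : H →ₗ[ℝ] ℝ)) (by exact_mod_cast hℓ) 1
  obtain ⟨B', hB', hB'B⟩ := exists_contDiff_eventuallyEq hB
  obtain ⟨C, hC, hCB⟩ := exists_contDiff_sub_eq_smul hB' ℓ e
  have hproj : Tendsto (fun w => w - ℓ w • e) (𝓝 0) (𝓝 0) := by
    have : Continuous fun w => w - ℓ w • e := by fun_prop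
    simpa using this.tendsto 0
  refine ⟨C, hC, ?_⟩
  filter_upwards [hB'B, hproj.eventually hB'B, hproj.eventually hzero] with w hw hpw hzero
  rw [← hCB w, hw, hpw, hzero (by simp [he]), sub_zero]

end Hadamard

section LocalDiffeomorphisms

variable {H V : Type*} [NormedAddCommGroup H] [NormedSpace ℝ H] [NormedAddCommGroup V]
  [NormedSpace ℝ V]

section

variable {HM HN : Type*} [TopologicalSpace HM] [TopologicalSpace HN] {I : ModelWithCorners ℝ H HM}
  {J : ModelWithCorners ℝ V HN} {M N : Type*} [TopologicalSpace M] [ChartedSpace HM M]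
  [TopologicalSpace N] [ChartedSpace HN N]

theorem isLocalDiffeomorphAt_of_contMDiffOn (κ : OpenPartialHomeomorph M N)
    (hκ : ContMDiffOn I J ∞ κ κ.source) (hκ' : ContMDiffOn J I ∞ κ.symm κ.target) {x : M}
    (hx : x ∈ κ.source) :
    IsLocalDiffeomorphAt I J ∞ κ x :=
  ⟨⟨κ.toPartialEquiv, κ.open_source, κ.open_target, hκ, hκ'⟩, hx, fun _ _ => rfl⟩

theorem isLocalDiffeomorphAt_congr {f g : M → N} {x : M} (hf : IsLocalDiffeomorphAt I J ∞ f x)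
    (hfg : f =ᶠ[𝓝 x] g) : IsLocalDiffeomorphAt I J ∞ g x := by
  obtain ⟨Φ, hx, hΦ⟩ := hf
  obtain ⟨U, hU, hUo, hxU⟩ := eventually_nhds_iff.1 hfg
  let κ := Φ.toOpenPartialHomeomorph.restrOpen U hUo
  exact ⟨⟨κ.toPartialEquiv, κ.open_source, κ.open_target,
    Φ.contMDiffOn_toFun.mono inter_subset_left, Φ.contMDiffOn_invFun.mono inter_subset_left⟩,
    ⟨hx, hxU⟩, fun z hz => (hU z hz.2).symm.trans (hΦ hz.1)⟩

theorem eventually_isLocalDiffeomorphAt {f : M → N} {x : M}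
    (hf : IsLocalDiffeomorphAt I J ∞ f x) : ∀ᶠ z in 𝓝 x, IsLocalDiffeomorphAt I J ∞ f z := by
  obtain ⟨Φ, hx, hΦ⟩ := hf
  filter_upwards [Φ.open_source.mem_nhds hx] with z hz
  exact ⟨Φ, hz, hΦ⟩

theorem map_nhds_eq_of_isLocalDiffeomorphAt {f : M → N} {x : M}
    (hf : IsLocalDiffeomorphAt I J ∞ f x) : map f (𝓝 x) = 𝓝 (f x) := by
  obtain ⟨Φ, hx, hΦ⟩ := hf
  rw [map_congr (hΦ.eventuallyEq_of_mem (Φ.open_source.mem_nhds hx)), hΦ hx]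
  exact Φ.toOpenPartialHomeomorph.map_nhds_eq hx

theorem mfderiv_bijective_of_isLocalDiffeomorphAt {f : M → N} {x : M}
    (hf : IsLocalDiffeomorphAt I J ∞ f x) : Function.Bijective (mfderiv I J f x) :=
  (hf.mfderivToContinuousLinearEquiv (by simp)).bijective

end

theorem isLocalDiffeomorphAt_of_hasFDerivAt [CompleteSpace H] {g : H → V} {a : H}
    (hg : ∀ᶠ z in 𝓝 a, ContDiffAt ℝ ∞ g z) {A : H ≃L[ℝ] V}
    (hA : HasFDerivAt g (A : H →L[ℝ] V) a) :
    IsLocalDiffeomorphAt 𝓘(ℝ, H) 𝓘(ℝ, V) ∞ g a := by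
  have hga := hg.self_of_nhds
  have hinv : ∀ᶠ z in 𝓝 a, fderiv ℝ g z ∈ range ((↑) : (H ≃L[ℝ] V) → H →L[ℝ] V) :=
    (hga.fderiv_right (m := ∞) (by norm_cast)).continuousAt.eventually
      (by rw [hA.fderiv]; exact ContinuousLinearEquiv.nhds A)
  obtain ⟨U, hU, hUo, haU⟩ := eventually_nhds_iff.1 (hg.and hinv)
  let e := (hga.toOpenPartialHomeomorph g hA (by simp)).restrOpen U hUo
  refine isLocalDiffeomorphAt_of_contMDiffOn e ?_ ?_
    ⟨hga.mem_toOpenPartialHomeomorph_source hA (by simp), haU⟩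
  · exact fun z hz => (hU z hz.2).1.contMDiffAt.contMDiffWithinAt
  · intro y hy
    obtain ⟨hsmooth, A', hA'⟩ := hU _ (e.map_target hy).2
    refine (e.contDiffAt_symm (f₀' := A') hy ?_ hsmooth).contMDiffAt.contMDiffWithinAt
    rw [hA']
    exact (hsmooth.differentiableAt (by simp)).hasFDerivAt

variable {M : Type*} [TopologicalSpace M] [ChartedSpace H M]

theorem isLocalDiffeomorphAt_of_mem_maximalAtlas {φ : OpenPartialHomeomorph M H}
    (hφ : φ ∈ IsManifold.maximalAtlas 𝓘(ℝ, H) ∞ M) {x : M} (hx : x ∈ φ.source) :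
    IsLocalDiffeomorphAt 𝓘(ℝ, H) 𝓘(ℝ, H) ∞ φ x :=
  isLocalDiffeomorphAt_of_contMDiffOn φ (contMDiffOn_of_mem_maximalAtlas hφ)
    (contMDiffOn_symm_of_mem_maximalAtlas hφ) hx

variable [IsManifold 𝓘(ℝ, H) ∞ M]

theorem exists_mem_maximalAtlas_of_isLocalDiffeomorphAt {G : M → H} {x : M}
    (hG : IsLocalDiffeomorphAt 𝓘(ℝ, H) 𝓘(ℝ, H) ∞ G x) :
    ∃ φ ∈ IsManifold.maximalAtlas 𝓘(ℝ, H) ∞ M, x ∈ φ.source ∧ EqOn G φ φ.source := by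
  obtain ⟨Φ, hx, hΦ⟩ := hG
  exact ⟨Φ.toOpenPartialHomeomorph, OpenPartialHomeomorph.mem_maximalAtlas_of_contMDiffOn _
    Φ.contMDiffOn_toFun Φ.contMDiffOn_invFun, hx, hΦ⟩

theorem isLocalDiffeomorphAt_of_mfderiv_injective [FiniteDimensional ℝ H] [FiniteDimensional ℝ V]
    (hrank : finrank ℝ H = finrank ℝ V) {G : M → V} {x : M}
    (hG : ∀ᶠ z in 𝓝 x, ContMDiffAt 𝓘(ℝ, H) 𝓘(ℝ, V) ∞ G z)
    (hd : Function.Injective (mfderiv 𝓘(ℝ, H) 𝓘(ℝ, V) G x)) :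
    IsLocalDiffeomorphAt 𝓘(ℝ, H) 𝓘(ℝ, V) ∞ G x := by
  have : CompleteSpace H := FiniteDimensional.complete ℝ H
  have hchart := IsManifold.chart_mem_maximalAtlas (I := 𝓘(ℝ, H)) (n := ∞) x
  set c := chartAt H x with hc
  have hxc : x ∈ c.source := mem_chart_source H x
  have hsymm : ∀ᶠ y in 𝓝 (c x), ContMDiffAt 𝓘(ℝ, H) 𝓘(ℝ, H) ∞ c.symm y := by
    filter_upwards [c.open_target.mem_nhds (c.map_source hxc)] with y hy
    exact contMDiffAt_symm_of_mem_maximalAtlas hchart hy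
  have hsmooth : ∀ᶠ y in 𝓝 (c x), ContDiffAt ℝ ∞ (G ∘ c.symm) y := by
    have hcont : Tendsto c.symm (𝓝 (c x)) (𝓝 x) := by
      simpa only [c.left_inv hxc] using (c.continuousAt_symm (c.map_source hxc)).tendsto
    filter_upwards [hsymm, hcont.eventually hG] with y hy hGy
    exact (hGy.comp y hy).contDiffAt
  have hfderiv : mfderiv 𝓘(ℝ, H) 𝓘(ℝ, V) G x = fderiv ℝ (G ∘ c.symm) (c x) := by
    refine (hG.self_of_nhds.mdifferentiableAt (by simp)).mfderiv.trans ?_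
    simp only [mfld_simps, fderivWithin_univ, hc]
    rfl
  rw [hfderiv] at hd
  let A := (LinearMap.linearEquivOfInjective (fderiv ℝ (G ∘ c.symm) (c x) : H →ₗ[ℝ] V) hd
    hrank).toContinuousLinearEquiv
  have hA : HasFDerivAt (G ∘ c.symm) (A : H →L[ℝ] V) (c x) :=
    (hsmooth.self_of_nhds.differentiableAt (by simp)).hasFDerivAt
  refine isLocalDiffeomorphAt_congr
    ((isLocalDiffeomorphAt_of_mem_maximalAtlas hchart hxc).comp 𝓘(ℝ, V) V
      (isLocalDiffeomorphAt_of_hasFDerivAt hsmooth hA)) ?_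
  filter_upwards [c.open_source.mem_nhds hxc] with z hz
  simp only [Function.comp_apply, c.left_inv hz]

end LocalDiffeomorphisms

section Coordinates

/-- The first `k` and the last `q` coordinates of a vector of `ℝ^N`, `N = k + q`. -/
def splitCoords {k q N : ℕ} (h : k + q = N) : E N ≃L[ℝ] E k × E q :=
  (LinearIsometryEquiv.piLpCongrLeft 2 ℝ ℝ (finCongr h.symm)).toContinuousLinearEquiv.trans
    EuclideanSpace.finAddEquivProd

/-- The first `r` coordinates and the last coordinate of a vector of `ℝ^(r+1)`. -/
def initLast (r : ℕ) : E (r + 1) ≃L[ℝ] E r × ℝ :=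
  LinearEquiv.toContinuousLinearEquiv
    { toFun := fun y => (WithLp.toLp 2 fun i => y i.castSucc, y (Fin.last r))
      invFun := fun z => WithLp.toLp 2 (Fin.snoc (α := fun _ => ℝ) z.1 z.2)
      map_add' := fun _ _ => rfl
      map_smul' := fun _ _ => rfl
      left_inv := fun y => by
        ext i
        induction i using Fin.lastCases <;> simp
      right_inv := fun z => by ext <;> simp }

section SplitCoords

variable {k q N : ℕ} (h : k + q = N)

theorem splitCoords_fst_apply (y : E N) (i : Fin k) :
    (splitCoords h y).1 i = y (Fin.cast h (Fin.castAdd q i)) := by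
  subst h
  rfl

theorem splitCoords_snd_apply (y : E N) (i : Fin q) :
    (splitCoords h y).2 i = y (Fin.cast h (Fin.natAdd k i)) := by
  subst h
  rfl

theorem sum_eq_sum_splitCoords (y : E N) (b : Fin N → ℝ → ℝ) :
    ∑ j, b j (y j) = ∑ i, b (Fin.cast h (Fin.castAdd q i)) ((splitCoords h y).1 i) +
      ∑ i, b (Fin.cast h (Fin.natAdd k i)) ((splitCoords h y).2 i) := by
  subst h
  exact Fin.sum_univ_add _

theorem norm_sq_eq_splitCoords (y : E N) :
    ‖y‖ ^ 2 = ‖(splitCoords h y).1‖ ^ 2 + ‖(splitCoords h y).2‖ ^ 2 := by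
  simp only [EuclideanSpace.real_norm_sq_eq]
  exact sum_eq_sum_splitCoords h y fun _ t => t ^ 2

theorem inner_eq_splitCoords (y z : E N) :
    inner ℝ y z = inner ℝ (splitCoords h y).1 (splitCoords h z).1 +
      inner ℝ (splitCoords h y).2 (splitCoords h z).2 := by
  have := norm_sq_eq_splitCoords h (y + z)
  rw [map_add, Prod.fst_add, Prod.snd_add, norm_add_sq_real, norm_add_sq_real, norm_add_sq_real,
    norm_sq_eq_splitCoords h y, norm_sq_eq_splitCoords h z] at this
  linarith

theorem norm_sq_splitCoords_symm (z : E k × E q) :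
    ‖(splitCoords h).symm z‖ ^ 2 = ‖z.1‖ ^ 2 + ‖z.2‖ ^ 2 := by
  rw [norm_sq_eq_splitCoords h, ContinuousLinearEquiv.apply_symm_apply]

end SplitCoords

theorem initLast_fst_apply {r : ℕ} (y : E (r + 1)) (i : Fin r) :
    (initLast r y).1 i = y i.castSucc :=
  rfl

theorem initLast_snd {r : ℕ} (y : E (r + 1)) : (initLast r y).2 = y (Fin.last r) :=
  rfl

theorem exists_norm_sq_eq_inner_sq_add_norm_sq {r : ℕ} {s : E (r + 1)} (hs : ‖s‖ = 1) :
    ∃ T : E (r + 1) →L[ℝ] E r, ∀ y, ‖y‖ ^ 2 = inner ℝ s y ^ 2 + ‖T y‖ ^ 2 := by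
  have hs0 : s ≠ 0 := by rintro rfl; simp at hs
  have := Fact.mk (@finrank_euclideanSpace_fin ℝ _ (r + 1))
  let U := (OrthonormalBasis.fromOrthogonalSpanSingleton (𝕜 := ℝ) r hs0).repr
  refine ⟨(U.toContinuousLinearEquiv : (ℝ ∙ s)ᗮ →L[ℝ] E r) ∘L
    (ℝ ∙ s)ᗮ.orthogonalProjectionOnto, fun y => ?_⟩
  have hproj : ((ℝ ∙ s).orthogonalProjectionOnto y : E (r + 1)) = inner ℝ s y • s :=
    Submodule.starProjection_unit_singleton ℝ hs y
  have hnorm : ‖(ℝ ∙ s).orthogonalProjectionOnto y‖ ^ 2 = inner ℝ s y ^ 2 := by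
    change ‖((ℝ ∙ s).orthogonalProjectionOnto y : E (r + 1))‖ ^ 2 = _
    rw [hproj, norm_smul, hs, mul_one, Real.norm_eq_abs, sq_abs]
  rw [Submodule.norm_sq_eq_add_norm_sq_projection y (ℝ ∙ s), hnorm]
  simp

end Coordinates

section FoldPoints

variable {n p : ℕ} {M N : Type*} [TopologicalSpace M] [ChartedSpace (E n) M]
  [TopologicalSpace N] [ChartedSpace (E n) N]

theorem isSingularPoint_iff_of_eventuallyEq {f : M → E p} {f₀ : N → E p} {g : M → N}
    {F : E p → E p} {x : M} (hf₀ : MDifferentiableAt (𝓡 n) (𝓡 p) f₀ (g x))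
    (hf : MDifferentiableAt (𝓡 n) (𝓡 p) f x)
    (hg : IsLocalDiffeomorphAt (𝓡 n) (𝓡 n) ∞ g x)
    (hF : IsLocalDiffeomorphAt (𝓡 p) (𝓡 p) ∞ F (f x)) (h : F ∘ f =ᶠ[𝓝 x] f₀ ∘ g) :
    IsSingularPoint n f x ↔ IsSingularPoint n f₀ (g x) := by
  have hderiv := h.mfderiv_eq (I := 𝓡 n) (I' := 𝓡 p)
  rw [mfderiv_comp x (hF.mdifferentiableAt (by simp)) hf,
    mfderiv_comp x hf₀ (hg.mdifferentiableAt (by simp))] at hderiv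
  have hg' := mfderiv_bijective_of_isLocalDiffeomorphAt hg
  have hF' := mfderiv_bijective_of_isLocalDiffeomorphAt hF
  have hfun : ⇑(mfderiv (𝓡 p) (𝓡 p) F (f x)) ∘ mfderiv (𝓡 n) (𝓡 p) f x =
      mfderiv (𝓡 n) (𝓡 p) f₀ (g x) ∘ mfderiv (𝓡 n) (𝓡 n) g x := congrArg DFunLike.coe hderiv
  refine not_congr ⟨fun hsurj => ?_, fun hsurj => ?_⟩
  · exact Function.Surjective.of_comp (hfun ▸ hF'.2.comp hsurj)
  · exact ((hfun ▸ hsurj.comp hg'.2 : Function.Surjective _)).of_comp_left hF'.1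

variable [IsManifold (𝓡 n) ∞ M]

theorem isFoldPointWith_of_isLocalDiffeomorphAt {l : ℕ} {f : M → E p} {x : M}
    (hf : ContinuousAt f x) {ψ : E p → E p} (hψ : IsLocalDiffeomorphAt (𝓡 p) (𝓡 p) ∞ ψ (f x))
    {G : M → E n} (hG : IsLocalDiffeomorphAt (𝓡 n) (𝓡 n) ∞ G x) (hGx : G x = 0)
    (h : ∀ᶠ z in 𝓝 x,
      (∀ (i : Fin p) (j : Fin n), (i : ℕ) = j → (i : ℕ) + 1 < p → ψ (f z) i = G z j) ∧
      (∀ i : Fin p, (i : ℕ) + 1 = p → ψ (f z) i =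
        ∑ j : Fin n, if (j : ℕ) + 1 < p then 0
          else if (j : ℕ) + 1 < p + l then (G z j) ^ 2 else -(G z j) ^ 2)) :
    IsFoldPointWith n l f x := by
  obtain ⟨φ, hφ, hxφ, hφG⟩ := exists_mem_maximalAtlas_of_isLocalDiffeomorphAt hG
  obtain ⟨χ, hχ, hxχ, hχψ⟩ := exists_mem_maximalAtlas_of_isLocalDiffeomorphAt hψ
  obtain ⟨U, hU, hUo, hxU⟩ := eventually_nhds_iff.1
    (h.and (hf.eventually (χ.open_source.mem_nhds hxχ)))
  have hsource {z : M} (hz : z ∈ (φ.restr U).source) : z ∈ φ.source ∧ z ∈ U := by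
    rwa [φ.restr_source' U hUo] at hz
  refine ⟨φ.restr U, restr_mem_maximalAtlas _ hφ hUo, χ, hχ, ?_, (hφG hxφ).symm.trans hGx,
    fun z hz => (hU z (hsource hz).2).2, fun z hz => ?_⟩
  · rw [φ.restr_source' U hUo]
    exact ⟨hxφ, hxU⟩
  · obtain ⟨hfold, hzχ⟩ := hU z (hsource hz).2
    rw [hφG (hsource hz).1, hχψ hzχ] at hfold
    exact hfold

theorem isFoldPointWith_of_eventuallyEq {l : ℕ} {f : M → E p} {f₀ : N → E p} {g : M → N}
    {F : E p → E p} {x : M} (hf₀ : IsFoldPointWith n l f₀ (g x))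
    (hf : ContinuousAt f x) (hg : IsLocalDiffeomorphAt (𝓡 n) (𝓡 n) ∞ g x)
    (hF : IsLocalDiffeomorphAt (𝓡 p) (𝓡 p) ∞ F (f x)) (h : F ∘ f =ᶠ[𝓝 x] f₀ ∘ g) :
    IsFoldPointWith n l f x := by
  obtain ⟨φ, hφ, ψ, hψ, hxφ, hφx, hmaps, hfold⟩ := hf₀
  have hFx : F (f x) = f₀ (g x) := h.self_of_nhds
  refine isFoldPointWith_of_isLocalDiffeomorphAt hf (ψ := ψ ∘ F) (G := φ ∘ g)
    (hF.comp (𝓡 p) (E p) (isLocalDiffeomorphAt_of_mem_maximalAtlas hψ (hFx ▸ hmaps hxφ)))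
    (hg.comp (𝓡 n) (E n) (isLocalDiffeomorphAt_of_mem_maximalAtlas hφ hxφ)) hφx ?_
  filter_upwards [h, hg.contMDiffAt.continuousAt.eventually (φ.open_source.mem_nhds hxφ)]
    with z hz hgz
  have hz' : F (f z) = f₀ (g z) := hz
  simpa only [Function.comp_apply, hz'] using hfold (g z) hgz

theorem isDefiniteFoldPoint_of_eventuallyEq {f : M → E p} {f₀ : N → E p} {g : M → N}
    {F : E p → E p} {x : M} (hf₀ : IsDefiniteFoldPoint n f₀ (g x))
    (hf : ContinuousAt f x) (hg : IsLocalDiffeomorphAt (𝓡 n) (𝓡 n) ∞ g x)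
    (hF : IsLocalDiffeomorphAt (𝓡 p) (𝓡 p) ∞ F (f x)) (h : F ∘ f =ᶠ[𝓝 x] f₀ ∘ g) :
    IsDefiniteFoldPoint n f x := by
  obtain ⟨l, hl, hmax, hfold⟩ := hf₀
  exact ⟨l, hl, hmax, isFoldPointWith_of_eventuallyEq hfold hf hg hF h⟩

end FoldPoints

section FoldModel

section Model

variable {U F : Type*} [NormedAddCommGroup F]

/-- The normal form `(u, a) ↦ (u, σ ‖a‖²)` of a definite fold, free of coordinates. A nonzero
factor `σ` stands for the sign of the fold. -/
def foldModel (σ : ℝ) (z : U × F) : U × ℝ := (z.1, σ * ‖z.2‖ ^ 2)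

theorem foldModel_prodMk_zero (σ : ℝ) (u : U) : foldModel σ (u, (0 : F)) = (u, 0) := by
  simp [foldModel]

variable [NormedAddCommGroup U]

theorem foldModel_zero (σ : ℝ) : foldModel σ (0 : U × F) = 0 :=
  foldModel_prodMk_zero σ 0

variable [InnerProductSpace ℝ F] [NormedSpace ℝ U]

theorem contDiff_foldModel (σ : ℝ) : ContDiff ℝ ∞ (foldModel σ : U × F → U × ℝ) :=
  contDiff_fst.prodMk (contDiff_const.mul (contDiff_snd.norm_sq ℝ))

theorem hasFDerivAt_foldModel_prodMk_zero (σ : ℝ) (u : U) :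
    HasFDerivAt (foldModel σ) ((ContinuousLinearMap.fst ℝ U F).prod 0) (u, (0 : F)) := by
  have hsq := ((hasFDerivAt_snd (𝕜 := ℝ) (p := (u, (0 : F)))).norm_sq).const_mul σ
  simp only [map_zero, ContinuousLinearMap.zero_comp, smul_zero] at hsq
  exact hasFDerivAt_fst.prodMk hsq

end Model

variable {n r k : ℕ}

theorem initLast_eq_foldModel_iff (h : r + k = n) {σ : ℝ} {y : E n} {w : E (r + 1)} :
    initLast r w = foldModel σ (splitCoords h y) ↔
      (∀ (i : Fin (r + 1)) (j : Fin n), (i : ℕ) = j → (i : ℕ) + 1 < r + 1 → w i = y j) ∧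
      ∀ i : Fin (r + 1), (i : ℕ) + 1 = r + 1 →
        w i = ∑ j : Fin n, if (j : ℕ) + 1 < r + 1 then 0 else σ * y j ^ 2 := by
  subst h
  have hsum : (∑ j : Fin (r + k), if (j : ℕ) + 1 < r + 1 then 0 else σ * y j ^ 2) =
      σ * ‖(splitCoords rfl y).2‖ ^ 2 := by
    simp [Fin.sum_univ_add, EuclideanSpace.real_norm_sq_eq, splitCoords_snd_apply, Finset.mul_sum]
  rw [hsum, foldModel, Prod.ext_iff, PiLp.ext_iff]
  refine and_congr ⟨fun hw i j hij hi => ?_, fun hw i => ?_⟩ ⟨fun hw i hi => ?_, fun hw => ?_⟩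
  · obtain ⟨i, rfl⟩ : ∃ i' : Fin r, i = i'.castSucc := ⟨⟨i, by omega⟩, rfl⟩
    obtain rfl : j = Fin.castAdd k i := Fin.ext hij.symm
    exact (hw i).trans (splitCoords_fst_apply rfl y i)
  · exact (hw i.castSucc (Fin.castAdd k i) rfl (by simp)).trans (splitCoords_fst_apply rfl y i).symm
  · obtain rfl : i = Fin.last r := Fin.ext (by simpa using hi)
    exact hw
  · exact hw (Fin.last r) rfl

variable {M : Type*} [TopologicalSpace M] [ChartedSpace (E n) M] {f : M → E (r + 1)} {x : M}

theorem isDefiniteFoldPoint_of_foldModel [IsManifold (𝓡 n) ∞ M] (h : r + k = n)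
    (hf : ContinuousAt f x) {ψ : E (r + 1) → E r × ℝ}
    (hψ : IsLocalDiffeomorphAt (𝓡 (r + 1)) 𝓘(ℝ, E r × ℝ) ∞ ψ (f x)) {A : M → E r × E k}
    (hA : IsLocalDiffeomorphAt (𝓡 n) 𝓘(ℝ, E r × E k) ∞ A x) (hAx : A x = 0)
    (hfA : ψ ∘ f =ᶠ[𝓝 x] foldModel 1 ∘ A) : IsDefiniteFoldPoint n f x := by
  refine ⟨n - (r + 1) + 1, le_rfl, by omega, isFoldPointWith_of_isLocalDiffeomorphAt hf
    (ψ := (initLast r).symm ∘ ψ) (G := (splitCoords h).symm ∘ A)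
    (hψ.comp (𝓡 (r + 1)) _ ((initLast r).symm.toDiffeomorph.isLocalDiffeomorph _))
    (hA.comp (𝓡 n) _ ((splitCoords h).symm.toDiffeomorph.isLocalDiffeomorph _)) (by simp [hAx]) ?_⟩
  filter_upwards [hfA] with z hz
  have hindex (j : Fin n) : (j : ℕ) + 1 < r + 1 + (n - (r + 1) + 1) := by omega
  simpa only [Function.comp_apply, hindex, if_true, one_mul] using
    (initLast_eq_foldModel_iff h (σ := 1) (y := (splitCoords h).symm (A z))
      (w := (initLast r).symm (ψ (f z)))).1 (by simpa using hz)

theorem IsDefiniteFoldPoint.exists_foldModel (h : r + k = n) (hx : IsDefiniteFoldPoint n f x) :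
    ∃ (σ : ℝ) (Θ : E r × ℝ → E (r + 1)) (A : M → E r × E k), σ ≠ 0 ∧
      IsLocalDiffeomorphAt 𝓘(ℝ, E r × ℝ) (𝓡 (r + 1)) ∞ Θ 0 ∧
      IsLocalDiffeomorphAt (𝓡 n) 𝓘(ℝ, E r × E k) ∞ A x ∧ A x = 0 ∧
      f =ᶠ[𝓝 x] Θ ∘ foldModel σ ∘ A := by
  obtain ⟨l, hl, hmax, φ, hφ, ψ, hψ, hxφ, hφx, hmaps, hfold⟩ := hx
  obtain ⟨σ, hσ, hsign⟩ : ∃ σ : ℝ, σ ≠ 0 ∧ ∀ (j : Fin n) (t : ℝ), ¬ (j : ℕ) + 1 < r + 1 →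
      (if (j : ℕ) + 1 < r + 1 + l then t else -t) = σ * t := by
    obtain rfl | rfl : l = n - (r + 1) + 1 ∨ l = 0 := by omega
    · exact ⟨1, one_ne_zero, fun j t _ => by rw [if_pos (by omega), one_mul]⟩
    · exact ⟨-1, by simp, fun j t hj => by rw [if_neg (by omega), neg_one_mul]⟩
  have hnormal (z : M) (hz : z ∈ φ.source) :
      initLast r (ψ (f z)) = foldModel σ (splitCoords h (φ z)) := by
    refine (initLast_eq_foldModel_iff h).2 ⟨(hfold z hz).1, fun i hi => ?_⟩
    rw [(hfold z hz).2 i hi]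
    refine Finset.sum_congr rfl fun j _ => ?_
    by_cases hj : (j : ℕ) + 1 < r + 1
    · rw [if_pos hj, if_pos hj]
    · rw [if_neg hj, if_neg hj]
      exact hsign j _ hj
  have hsymm_zero : (initLast r).symm 0 = ψ (f x) := by
    rw [← foldModel_zero (U := E r) (F := E k) σ, ← map_zero (splitCoords h), ← hφx,
      ← hnormal x hxφ, ContinuousLinearEquiv.symm_apply_apply]
  refine ⟨σ, ψ.symm ∘ (initLast r).symm, splitCoords h ∘ φ, hσ, ?_, ?_,
    by rw [Function.comp_apply, hφx, map_zero], ?_⟩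
  · refine ((initLast r).symm.toDiffeomorph.isLocalDiffeomorph _).comp (𝓡 (r + 1)) (E (r + 1)) ?_
    have : IsLocalDiffeomorphAt (𝓡 (r + 1)) (𝓡 (r + 1)) ∞ ψ.symm ((initLast r).symm 0) := by
      rw [hsymm_zero]
      exact isLocalDiffeomorphAt_of_contMDiffOn ψ.symm (contMDiffOn_symm_of_mem_maximalAtlas hψ)
        (by simpa using contMDiffOn_of_mem_maximalAtlas hψ) (ψ.map_source (hmaps hxφ))
    exact this
  · exact (isLocalDiffeomorphAt_of_mem_maximalAtlas hφ hxφ).comp 𝓘(ℝ, E r × E k) _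
      ((splitCoords h).toDiffeomorph.isLocalDiffeomorph _)
  · filter_upwards [φ.open_source.mem_nhds hxφ] with z hz
    simp only [Function.comp_apply, ← hnormal z hz, ContinuousLinearEquiv.symm_apply_apply,
      ψ.left_inv (hmaps hz)]

end FoldModel

section NormDefect

variable {V F : Type*} [NormedAddCommGroup V] [NormedAddCommGroup F] [InnerProductSpace ℝ F] {σ : ℝ}

section

variable {U : Type*} [NormedAddCommGroup U] [NormedSpace ℝ U] {Θ : U × ℝ → V} {C : U × ℝ → ℝ}

theorem pos_of_norm_comp_foldModel_le_one [Nontrivial F] (hC : ContinuousAt C 0) (hC0 : C 0 ≠ 0)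
    (hσ : σ ≠ 0) (h : ∀ᶠ w in 𝓝 0, 1 - ‖Θ w‖ ^ 2 = w.2 * C w)
    (hball : ∀ᶠ y in 𝓝 (0 : U × F), ‖Θ (foldModel σ y)‖ ≤ 1) : 0 < σ * C 0 := by
  obtain ⟨v, hv⟩ := exists_ne (0 : F)
  let c : ℝ → U × F := fun t => (0, t • v)
  have hc : Tendsto c (𝓝[≠] 0) (𝓝 0) := by
    have : Continuous c := by fun_prop
    have hc0 : c 0 = 0 := by simp [c]
    simpa only [hc0] using (this.tendsto 0).mono_left nhdsWithin_le_nhds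
  have hfold : Tendsto (fun t => foldModel σ (c t)) (𝓝[≠] 0) (𝓝 0) := by
    have := (contDiff_foldModel (U := U) (F := F) σ).continuous.tendsto 0
    rw [foldModel_zero] at this
    exact this.comp hc
  refine lt_of_le_of_ne (ge_of_tendsto ((hC.tendsto.comp hfold).const_mul σ) ?_)
    (mul_ne_zero hσ hC0).symm
  filter_upwards [hfold.eventually h, hc.eventually hball, self_mem_nhdsWithin] with t hdef hle ht
  have hpos : 0 < ‖t • v‖ ^ 2 := pow_pos (norm_pos_iff.2 (smul_ne_zero ht hv)) 2
  have hnonneg : 0 ≤ ‖t • v‖ ^ 2 * (σ * C (foldModel σ (c t))) := by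
    calc 0 ≤ 1 - ‖Θ (foldModel σ (c t))‖ ^ 2 :=
          sub_nonneg.2 (pow_le_one₀ (norm_nonneg _) hle)
      _ = ‖t • v‖ ^ 2 * (σ * C (foldModel σ (c t))) := by
          rw [hdef, show (foldModel σ (c t)).2 = σ * ‖t • v‖ ^ 2 from rfl]
          ring
  exact nonneg_of_mul_nonneg_right hnonneg hpos

variable [InnerProductSpace ℝ V]

theorem ne_zero_of_one_sub_norm_sq_eq_mul {Θ' : U × ℝ →L[ℝ] V} (hΘ : HasFDerivAt Θ Θ' 0)
    (hsurj : Function.Surjective Θ') (hC : DifferentiableAt ℝ C 0)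
    (h : ∀ᶠ w in 𝓝 0, 1 - ‖Θ w‖ ^ 2 = w.2 * C w) : C 0 ≠ 0 := by
  intro hC0
  have hderiv := (hΘ.norm_sq.const_sub 1).unique
    ((hasFDerivAt_snd.mul hC.hasFDerivAt).congr_of_eventuallyEq h)
  obtain ⟨w, hw⟩ := hsurj (Θ 0)
  have hΘ0 : ‖Θ 0‖ = 0 := by
    have := DFunLike.congr_fun hderiv w
    simpa [hC0, hw] using this
  simpa [hΘ0] using h.self_of_nhds

end

variable {U : Type} [NormedAddCommGroup U] [NormedSpace ℝ U] [FiniteDimensional ℝ U]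
  [InnerProductSpace ℝ V] {Θ : U × ℝ → V}

theorem exists_contDiff_one_sub_norm_sq_eq_mul
    (hΘ : ∀ᶠ w in 𝓝 0, ContDiffAt ℝ ∞ Θ w)
    (hsphere : ∀ᶠ u in 𝓝 (0 : U), ‖Θ (u, 0)‖ = 1) :
    ∃ C : U × ℝ → ℝ, ContDiff ℝ ∞ C ∧ ∀ᶠ w in 𝓝 0, 1 - ‖Θ w‖ ^ 2 = w.2 * C w := by
  have hsnd : ContinuousLinearMap.snd ℝ U ℝ ≠ 0 := fun h => by
    simpa using DFunLike.congr_fun h ((0 : U), (1 : ℝ))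
  refine exists_contDiff_eventually_eq_smul
    (hΘ.mono fun w hw => contDiffAt_const.sub (hw.norm_sq ℝ)) hsnd ?_
  filter_upwards [(continuous_fst.tendsto (0 : U × ℝ)).eventually hsphere] with w hw hw0
  obtain ⟨u, t⟩ := w
  obtain rfl : t = 0 := hw0
  simp [hw]

theorem exists_norm_sq_add_norm_smul_sq_eq_one [Nontrivial F]
    (hΘ : ∀ᶠ w in 𝓝 0, ContDiffAt ℝ ∞ Θ w)
    (hsurj : Function.Surjective (fderiv ℝ Θ 0)) (hsphere : ∀ᶠ u in 𝓝 (0 : U), ‖Θ (u, 0)‖ = 1)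
    (hσ : σ ≠ 0) (hball : ∀ᶠ y in 𝓝 (0 : U × F), ‖Θ (foldModel σ y)‖ ≤ 1) :
    ∃ κ : U × F → ℝ, κ 0 ≠ 0 ∧ (∀ᶠ y in 𝓝 0, ContDiffAt ℝ ∞ κ y) ∧
      ∀ᶠ y in 𝓝 (0 : U × F), ‖Θ (foldModel σ y)‖ ^ 2 + ‖κ y • y.2‖ ^ 2 = 1 := by
  obtain ⟨C, hC, hΘC⟩ := exists_contDiff_one_sub_norm_sq_eq_mul hΘ hsphere
  have hC0 := ne_zero_of_one_sub_norm_sq_eq_mul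
    (hΘ.self_of_nhds.differentiableAt (by simp)).hasFDerivAt hsurj
    (hC.differentiable (by simp) 0) hΘC
  have hfold : Tendsto (foldModel σ) (𝓝 (0 : U × F)) (𝓝 0) := by
    simpa only [foldModel_zero] using (contDiff_foldModel (U := U) (F := F) σ).continuous.tendsto 0
  let K : U × F → ℝ := fun y => σ * C (foldModel σ y)
  have hK : ContDiff ℝ ∞ K := contDiff_const.mul (hC.comp (contDiff_foldModel σ))
  have hK0 : 0 < K 0 := by
    simpa only [K, foldModel_zero] using
      pos_of_norm_comp_foldModel_le_one hC.continuous.continuousAt hC0 hσ hΘC hball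
  have hKpos : ∀ᶠ y in 𝓝 0, 0 < K y := hK.continuous.continuousAt.eventually (lt_mem_nhds hK0)
  refine ⟨fun y => √(K y), (Real.sqrt_pos.2 hK0).ne', hKpos.mono fun y hy =>
    hK.contDiffAt.sqrt hy.ne', ?_⟩
  filter_upwards [hfold.eventually hΘC, hKpos] with y hy hyK
  rw [norm_smul, mul_pow, Real.norm_eq_abs, sq_abs, Real.sq_sqrt hyK.le]
  have hlast : (foldModel σ y).2 = σ * ‖y.2‖ ^ 2 := rfl
  linear_combination -hy - C (foldModel σ y) * hlast

end NormDefect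

section SphericalLift

variable {n r k : ℕ} {M : Type*} [TopologicalSpace M] [ChartedSpace (E n) M]

section Definition

variable {V F : Type*} [NormedAddCommGroup V] [NormedSpace ℝ V] [NormedAddCommGroup F]
  [NormedSpace ℝ F]

variable (n) in
/-- Near `x` the map `q` is an immersion into the unit sphere of `V × F` (for the Euclidean norm)
with first component `f`, so that `f` is the projection of a piece of this sphere to `V`; the point
`x` itself is mapped to the great sphere in `V`. -/
structure IsSphericalLift (f : M → V) (q : M → V × F) (x : M) : Prop where
  smooth : ∀ᶠ z in 𝓝 x, ContMDiffAt (𝓡 n) 𝓘(ℝ, V × F) ∞ q z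
  fst_eq : ∀ᶠ z in 𝓝 x, (q z).1 = f z
  norm_sq_add_norm_sq : ∀ᶠ z in 𝓝 x, ‖(q z).1‖ ^ 2 + ‖(q z).2‖ ^ 2 = 1
  snd_eq_zero : (q x).2 = 0
  mfderiv_injective : Function.Injective (mfderiv (𝓡 n) 𝓘(ℝ, V × F) q x)

variable {f : M → V} {q : M → V × F} {x : M}

theorem IsSphericalLift.hasMFDerivAt (h : IsSphericalLift n f q x) :
    HasMFDerivAt (𝓡 n) 𝓘(ℝ, V × F) q x (mfderiv (𝓡 n) 𝓘(ℝ, V × F) q x) :=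
  (h.smooth.self_of_nhds.mdifferentiableAt (by simp)).hasMFDerivAt

theorem IsSphericalLift.hasMFDerivAt_fst (h : IsSphericalLift n f q x) :
    HasMFDerivAt (𝓡 n) 𝓘(ℝ, V) f x
      (ContinuousLinearMap.fst ℝ V F ∘L mfderiv (𝓡 n) 𝓘(ℝ, V × F) q x) :=
  ((ContinuousLinearMap.fst ℝ V F).hasMFDerivAt.comp x h.hasMFDerivAt).congr_of_eventuallyEq
    (h.fst_eq.mono fun _ hz => hz.symm)

theorem IsSphericalLift.norm_eq_one (h : IsSphericalLift n f q x) : ‖f x‖ = 1 := by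
  have := h.norm_sq_add_norm_sq.self_of_nhds
  rw [h.snd_eq_zero, h.fst_eq.self_of_nhds, norm_zero, zero_pow two_ne_zero, add_zero] at this
  exact (pow_eq_one_iff_of_nonneg (norm_nonneg _) two_ne_zero).1 this

theorem IsSphericalLift.comp_continuousLinearMap {V' F' : Type*} [NormedAddCommGroup V']
    [NormedSpace ℝ V'] [NormedAddCommGroup F'] [NormedSpace ℝ F'] (h : IsSphericalLift n f q x)
    {L : V × F →L[ℝ] V' × F'} (hL : ∀ w, ‖(L w).1‖ ^ 2 + ‖(L w).2‖ ^ 2 = ‖w.1‖ ^ 2 + ‖w.2‖ ^ 2)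
    {f' : M → V'} (hf' : ∀ᶠ z in 𝓝 x, (L (q z)).1 = f' z) (hx : (L (q x)).2 = 0) :
    IsSphericalLift n f' (L ∘ q) x where
  smooth := h.smooth.mono fun z hz => L.contMDiff.contMDiffAt.comp z hz
  fst_eq := hf'
  norm_sq_add_norm_sq := h.norm_sq_add_norm_sq.mono fun z hz => (hL (q z)).trans hz
  snd_eq_zero := hx
  mfderiv_injective := by
    rw [(L.hasMFDerivAt.comp x h.hasMFDerivAt).mfderiv]
    have hLinj : Function.Injective L := (injective_iff_map_eq_zero L).2 fun w hw => by
      have hnorm := hL w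
      rw [hw, Prod.fst_zero, Prod.snd_zero, norm_zero, norm_zero] at hnorm
      refine Prod.ext ?_ ?_ <;> refine norm_eq_zero.1 (pow_eq_zero_iff two_ne_zero |>.1 ?_) <;>
        nlinarith [sq_nonneg ‖w.1‖, sq_nonneg ‖w.2‖]
    exact hLinj.comp h.mfderiv_injective

end Definition

section InnerProduct

variable {V F W : Type*} [NormedAddCommGroup V] [InnerProductSpace ℝ V] [NormedAddCommGroup F]
  [InnerProductSpace ℝ F] {f : M → V} {q : M → V × F} {x : M}

theorem IsSphericalLift.inner_fst_mfderiv_eq_zero (h : IsSphericalLift n f q x)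
    (ξ : TangentSpace (𝓡 n) x) :
    inner ℝ (f x) (mfderiv (𝓡 n) 𝓘(ℝ, V × F) q x ξ : V × F).1 = 0 := by
  have hsq := (((hasStrictFDerivAt_norm_sq (q x).1).hasFDerivAt.comp (q x) hasFDerivAt_fst).add
    ((hasStrictFDerivAt_norm_sq (q x).2).hasFDerivAt.comp (q x) hasFDerivAt_snd)).hasMFDerivAt
  have hconst := hasMFDerivAt_unique
    ((hasMFDerivAt_const (1 : ℝ) x).congr_of_eventuallyEq h.norm_sq_add_norm_sq)
    (hsq.comp x h.hasMFDerivAt)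
  have heval : (0 : ℝ) = (2 : ℕ) • inner ℝ (q x).1 (mfderiv (𝓡 n) 𝓘(ℝ, V × F) q x ξ : V × F).1 +
      (2 : ℕ) • inner ℝ (q x).2 (mfderiv (𝓡 n) 𝓘(ℝ, V × F) q x ξ : V × F).2 :=
    DFunLike.congr_fun hconst ξ
  rw [h.fst_eq.self_of_nhds, h.snd_eq_zero, inner_zero_left, nsmul_zero, add_zero,
    two_nsmul] at heval
  linarith

theorem IsSphericalLift.not_surjective_mfderiv (h : IsSphericalLift n f q x) :
    ¬ Function.Surjective (mfderiv (𝓡 n) 𝓘(ℝ, V) f x) := by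
  intro hsurj
  obtain ⟨ξ, hξ⟩ := hsurj (f x)
  have hinner := h.inner_fst_mfderiv_eq_zero ξ
  rw [h.hasMFDerivAt_fst.mfderiv] at hξ
  rw [show (mfderiv (𝓡 n) 𝓘(ℝ, V × F) q x ξ : V × F).1 = f x from hξ,
    real_inner_self_eq_norm_sq, h.norm_eq_one] at hinner
  norm_num at hinner

variable [NormedAddCommGroup W] [NormedSpace ℝ W] [FiniteDimensional ℝ W]

theorem isLocalDiffeomorphAt_prodMk_one_sub_norm_sq [FiniteDimensional ℝ V]
    {p : V} {T : V →L[ℝ] W} (hT : ∀ y, ‖y‖ ^ 2 = inner ℝ p y ^ 2 + ‖T y‖ ^ 2)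
    (hrank : finrank ℝ V = finrank ℝ W + 1) :
    IsLocalDiffeomorphAt 𝓘(ℝ, V) 𝓘(ℝ, W × ℝ) ∞ (fun w => (T w, 1 - ‖w‖ ^ 2)) p := by
  have hsmooth : ContDiff ℝ ∞ fun w : V => (T w, 1 - ‖w‖ ^ 2) :=
    T.contDiff.prodMk (contDiff_const.sub (contDiff_norm_sq ℝ))
  have hderiv := T.hasFDerivAt.prodMk ((hasStrictFDerivAt_norm_sq p).hasFDerivAt.const_sub 1)
  refine isLocalDiffeomorphAt_of_mfderiv_injective (by simp [hrank])
    (Eventually.of_forall fun w => hsmooth.contDiffAt.contMDiffAt) ?_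
  rw [hderiv.hasMFDerivAt.mfderiv]
  refine (injective_iff_map_eq_zero _).2 fun (v : V) hv => ?_
  have hTv : T v = 0 := congrArg Prod.fst hv
  have hpv : inner ℝ p v = 0 := by
    have : -((2 : ℕ) • inner ℝ p v : ℝ) = 0 := congrArg Prod.snd hv
    simpa using this
  have hv0 : v = 0 := by simpa [hTv, hpv] using hT v
  exact hv0

theorem IsSphericalLift.isLocalDiffeomorphAt_prodMap [IsManifold (𝓡 n) ∞ M]
    [FiniteDimensional ℝ F] (h : IsSphericalLift n f q x)
    {T : V →L[ℝ] W} (hT : ∀ y, ‖y‖ ^ 2 = inner ℝ (f x) y ^ 2 + ‖T y‖ ^ 2)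
    (hrank : n = finrank ℝ W + finrank ℝ F) :
    IsLocalDiffeomorphAt (𝓡 n) 𝓘(ℝ, W × F) ∞ (T.prodMap (.id ℝ F) ∘ q) x := by
  let L : V × F →L[ℝ] W × F := T.prodMap (.id ℝ F)
  refine isLocalDiffeomorphAt_of_mfderiv_injective (by simp [← hrank])
    (h.smooth.mono fun z hz => L.contMDiff.contMDiffAt.comp z hz) ?_
  rw [(L.hasMFDerivAt.comp x h.hasMFDerivAt).mfderiv]
  refine (injective_iff_map_eq_zero _).2 fun ξ hξ => ?_
  let w : V × F := mfderiv (𝓡 n) 𝓘(ℝ, V × F) q x ξ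
  have hTw : T w.1 = 0 := congrArg Prod.fst hξ
  have hw₁ : w.1 = 0 := by
    simpa [hTw, show inner ℝ (f x) w.1 = 0 from h.inner_fst_mfderiv_eq_zero ξ] using hT w.1
  have hw₂ : w.2 = 0 := congrArg Prod.snd hξ
  exact (injective_iff_map_eq_zero _).1 h.mfderiv_injective ξ (Prod.ext hw₁ hw₂)

end InnerProduct

variable [IsManifold (𝓡 n) ∞ M] {f : M → E (r + 1)} {x : M}

theorem IsSphericalLift.isDefiniteFoldPoint (h : r + k = n) {q : M → E (r + 1) × E k}
    (hq : IsSphericalLift n f q x) (hf : ContinuousAt f x) : IsDefiniteFoldPoint n f x := by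
  obtain ⟨T, hT⟩ := exists_norm_sq_eq_inner_sq_add_norm_sq hq.norm_eq_one
  have hTx : T (f x) = 0 := by
    simpa [real_inner_self_eq_norm_sq, hq.norm_eq_one] using hT (f x)
  refine isDefiniteFoldPoint_of_foldModel h hf
    (isLocalDiffeomorphAt_prodMk_one_sub_norm_sq hT (by simp))
    (hq.isLocalDiffeomorphAt_prodMap hT (by simp [h])) (Prod.ext ?_ hq.snd_eq_zero) ?_
  · exact (congrArg T hq.fst_eq.self_of_nhds).trans hTx
  · filter_upwards [hq.fst_eq, hq.norm_sq_add_norm_sq] with z hfst hnorm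
    refine Prod.ext (congrArg T hfst.symm) ?_
    change 1 - ‖f z‖ ^ 2 = 1 * ‖(q z).2‖ ^ 2
    rw [← hfst]
    linarith

end SphericalLift

section SphericalLiftExistence

variable {n : ℕ} {M : Type*} [TopologicalSpace M] [ChartedSpace (E n) M]

section Model

variable {U V F : Type*} [NormedAddCommGroup U] [NormedSpace ℝ U] [NormedAddCommGroup V]
  [NormedAddCommGroup F] [InnerProductSpace ℝ F] {f : M → V}
  {Θ : U × ℝ → V} {σ : ℝ} {A : M → U × F} {x : M}

theorem eventually_norm_comp_foldModel_le_one
    (hA : IsLocalDiffeomorphAt (𝓡 n) 𝓘(ℝ, U × F) ∞ A x) (hAx : A x = 0)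
    (h : f =ᶠ[𝓝 x] Θ ∘ foldModel σ ∘ A) (hball : ∀ᶠ z in 𝓝 x, ‖f z‖ ≤ 1) :
    ∀ᶠ y in 𝓝 (0 : U × F), ‖Θ (foldModel σ y)‖ ≤ 1 := by
  rw [← hAx, ← map_nhds_eq_of_isLocalDiffeomorphAt hA, eventually_map]
  filter_upwards [h, hball] with z hz hle
  rw [hz] at hle
  exact hle

variable [NormedSpace ℝ V]

theorem not_surjective_mfderiv_comp_foldModel [FiniteDimensional ℝ U]
    (hrank : finrank ℝ U < finrank ℝ V) (hA : MDifferentiableAt (𝓡 n) 𝓘(ℝ, U × F) A x)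
    (hAx : (A x).2 = 0) (hΘ : DifferentiableAt ℝ Θ ((A x).1, 0))
    (h : f =ᶠ[𝓝 x] Θ ∘ foldModel σ ∘ A) :
    ¬ Function.Surjective (mfderiv (𝓡 n) 𝓘(ℝ, V) f x) := by
  intro hsurj
  have hAx' : A x = ((A x).1, 0) := Prod.ext rfl hAx
  have hΘfold : HasFDerivAt (Θ ∘ foldModel σ)
      (fderiv ℝ Θ ((A x).1, 0) ∘L (ContinuousLinearMap.fst ℝ U F).prod 0) (A x) := by
    rw [hAx']
    refine HasFDerivAt.comp _ ?_ (hasFDerivAt_foldModel_prodMk_zero σ _)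
    rw [foldModel_prodMk_zero]
    exact hΘ.hasFDerivAt
  have hcomp := (hΘfold.hasMFDerivAt.comp x hA.hasMFDerivAt).congr_of_eventuallyEq h
  rw [hcomp.mfderiv] at hsurj
  have hinl : Function.Surjective
      ((fderiv ℝ Θ ((A x).1, 0) : U × ℝ →ₗ[ℝ] V) ∘ₗ LinearMap.inl ℝ U ℝ) := fun v => by
    obtain ⟨ξ, hξ⟩ := hsurj v
    exact ⟨_, hξ⟩
  exact hrank.not_ge (LinearMap.finrank_le_finrank_of_surjective hinl)

theorem eventually_norm_prodMk_zero_eq_one [FiniteDimensional ℝ U]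
    (hrank : finrank ℝ U < finrank ℝ V)
    (hA : IsLocalDiffeomorphAt (𝓡 n) 𝓘(ℝ, U × F) ∞ A x) (hAx : A x = 0)
    (hΘ : ∀ᶠ w in 𝓝 0, ContDiffAt ℝ ∞ Θ w) (h : f =ᶠ[𝓝 x] Θ ∘ foldModel σ ∘ A)
    (hsphere : ∀ᶠ z in 𝓝 x,
      ¬ Function.Surjective (mfderiv (𝓡 n) 𝓘(ℝ, V) f z) → ‖f z‖ = 1) :
    ∀ᶠ u in 𝓝 (0 : U), ‖Θ (u, 0)‖ = 1 := by
  have hmap : map A (𝓝 x) = 𝓝 0 := hAx ▸ map_nhds_eq_of_isLocalDiffeomorphAt hA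
  have hΘA : ∀ᶠ z in 𝓝 x, ContDiffAt ℝ ∞ Θ ((A z).1, 0) := by
    have hcont : Tendsto (fun y : U × F => (y.1, (0 : ℝ))) (𝓝 0) (𝓝 0) :=
      Continuous.tendsto' (by fun_prop) _ _ rfl
    exact (hcont.comp hmap.le).eventually hΘ
  have hfold : ∀ᶠ y in 𝓝 (0 : U × F), y.2 = 0 → ‖Θ (y.1, 0)‖ = 1 := by
    rw [← hmap, eventually_map]
    filter_upwards [h.eventuallyEq_nhds, hsphere, eventually_isLocalDiffeomorphAt hA, hΘA]
      with z hz hzs hAz hΘz hz0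
    have hfz : f z = Θ ((A z).1, 0) := by
      rw [hz.self_of_nhds, ← foldModel_prodMk_zero (F := F) σ, ← hz0]
      rfl
    rw [← hfz]
    exact hzs (not_surjective_mfderiv_comp_foldModel hrank (hAz.mdifferentiableAt (by simp)) hz0
      (hΘz.differentiableAt (by simp)) hz)
  have hinl : Tendsto (fun u : U => (u, (0 : F))) (𝓝 0) (𝓝 0) :=
    Continuous.tendsto' (by fun_prop) _ _ rfl
  exact (hinl.eventually hfold).mono fun u hu => hu rfl

theorem hasFDerivAt_prodMk_smul_snd {κ : U × F → ℝ} {Θ' : U × ℝ →L[ℝ] V}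
    (hΘ : HasFDerivAt Θ Θ' 0) (hκ : DifferentiableAt ℝ κ 0) :
    HasFDerivAt (fun y => (Θ (foldModel σ y), κ y • y.2))
      ((Θ' ∘L (ContinuousLinearMap.fst ℝ U F).prod 0).prod (κ 0 • ContinuousLinearMap.snd ℝ U F))
      0 := by
  have hfold := hasFDerivAt_foldModel_prodMk_zero (F := F) σ (0 : U)
  have hfst : HasFDerivAt (Θ ∘ foldModel σ) _ (0 : U × F) :=
    HasFDerivAt.comp _ (by rwa [foldModel_zero]) hfold
  simpa using hfst.prodMk (hκ.hasFDerivAt.smul hasFDerivAt_snd)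

theorem isSphericalLift_of_foldModel {κ : U × F → ℝ}
    (hA : IsLocalDiffeomorphAt (𝓡 n) 𝓘(ℝ, U × F) ∞ A x) (hAx : A x = 0)
    (hΘ : ∀ᶠ w in 𝓝 0, ContDiffAt ℝ ∞ Θ w) (hΘ' : Function.Injective (fderiv ℝ Θ 0))
    (hκ : ∀ᶠ y in 𝓝 0, ContDiffAt ℝ ∞ κ y) (hκ0 : κ 0 ≠ 0)
    (hnorm : ∀ᶠ y in 𝓝 0, ‖Θ (foldModel σ y)‖ ^ 2 + ‖κ y • y.2‖ ^ 2 = 1)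
    (h : f =ᶠ[𝓝 x] Θ ∘ foldModel σ ∘ A) :
    IsSphericalLift n f (fun z => (Θ (foldModel σ (A z)), κ (A z) • (A z).2)) x := by
  have hA0 : Tendsto A (𝓝 x) (𝓝 0) := hAx ▸ (map_nhds_eq_of_isLocalDiffeomorphAt hA).le
  have hfold : Tendsto (foldModel σ) (𝓝 (0 : U × F)) (𝓝 0) := by
    simpa only [foldModel_zero] using (contDiff_foldModel (U := U) (F := F) σ).continuous.tendsto 0
  let Q : U × F → V × F := fun y => (Θ (foldModel σ y), κ y • y.2)
  have hQ : ∀ᶠ y in 𝓝 0, ContDiffAt ℝ ∞ Q y := by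
    filter_upwards [hfold.eventually hΘ, hκ] with y hΘy hκy
    exact (hΘy.comp y (contDiff_foldModel σ).contDiffAt).prodMk (hκy.smul contDiffAt_snd)
  refine ⟨?_, h.mono fun z hz => hz.symm, hA0.eventually hnorm, by simp [hAx], ?_⟩
  · filter_upwards [hA0.eventually hQ, eventually_isLocalDiffeomorphAt hA] with z hQz hAz
    exact hQz.contMDiffAt.comp z hAz.contMDiffAt
  · have hQ' := hasFDerivAt_prodMk_smul_snd (σ := σ)
      (hΘ.self_of_nhds.differentiableAt (by simp)).hasFDerivAt
      (hκ.self_of_nhds.differentiableAt (by simp))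
    rw [← hAx] at hQ'
    have hQinj : Function.Injective
        (((fderiv ℝ Θ 0) ∘L (ContinuousLinearMap.fst ℝ U F).prod 0).prod
          (κ 0 • ContinuousLinearMap.snd ℝ U F)) :=
      (injective_iff_map_eq_zero _).2 fun y hy => by
        have hu : (y.1, (0 : ℝ)) = 0 := (injective_iff_map_eq_zero _).1 hΘ' _ (congrArg Prod.fst hy)
        have ha : κ 0 • y.2 = 0 := congrArg Prod.snd hy
        exact Prod.ext (Prod.mk_eq_zero.1 hu).1 ((smul_eq_zero.1 ha).resolve_left hκ0)
    have hQA := (hQ'.hasMFDerivAt.comp x (hA.mdifferentiableAt (by simp)).hasMFDerivAt).mfderiv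
    change Function.Injective (mfderiv (𝓡 n) 𝓘(ℝ, V × F) (Q ∘ A) x)
    rw [hQA, hAx]
    exact hQinj.comp (mfderiv_bijective_of_isLocalDiffeomorphAt hA).1

end Model

theorem IsDefiniteFoldPoint.exists_isSphericalLift {r k : ℕ} [NeZero k] (h : r + k = n)
    {f : M → E (r + 1)} {x : M} (hx : IsDefiniteFoldPoint n f x)
    (hball : ∀ᶠ z in 𝓝 x, ‖f z‖ ≤ 1) (hsphere : ∀ᶠ z in 𝓝 x, IsSingularPoint n f z → ‖f z‖ = 1) :
    ∃ q : M → E (r + 1) × E k, IsSphericalLift n f q x := by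
  obtain ⟨σ, Θ, A, hσ, hΘ, hA, hAx, hfA⟩ := hx.exists_foldModel h
  have hΘsmooth : ∀ᶠ w in 𝓝 0, ContDiffAt ℝ ∞ Θ w :=
    (eventually_isLocalDiffeomorphAt hΘ).mono fun w hw => hw.contMDiffAt.contDiffAt
  have hΘ' : Function.Bijective (fderiv ℝ Θ 0) := by
    rw [← mfderiv_eq_fderiv]
    exact mfderiv_bijective_of_isLocalDiffeomorphAt hΘ
  obtain ⟨κ, hκ0, hκ, hnorm⟩ := exists_norm_sq_add_norm_smul_sq_eq_one hΘsmooth hΘ'.2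
    (eventually_norm_prodMk_zero_eq_one (by simp) hA hAx hΘsmooth hfA hsphere) hσ
    (eventually_norm_comp_foldModel_le_one hA hAx hfA hball)
  exact ⟨_, isSphericalLift_of_foldModel hA hAx hΘsmooth hΘ'.1 hκ hκ0 hnorm hfA⟩

end SphericalLiftExistence

section HeightFunctions

variable {n p r k : ℕ} {M : Type*} [TopologicalSpace M] [ChartedSpace (E n) M]

/-- The height function in the direction `s`, with values in `ℝ^1`. -/
def height (s : E p) : E p →L[ℝ] E 1 :=
  LinearMap.toContinuousLinearMap
    { toFun := fun y => !₂[inner ℝ s y]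
      map_add' := fun y z => by ext i; fin_cases i; simp [inner_add_right]
      map_smul' := fun c y => by ext i; fin_cases i; simp [inner_smul_right] }

theorem height_apply (s y : E p) : height s y = !₂[inner ℝ s y] := rfl

theorem norm_sq_height (s y : E p) : ‖height s y‖ ^ 2 = inner ℝ s y ^ 2 := by
  simp [EuclideanSpace.real_norm_sq_eq, height_apply]

theorem inner_mfderiv_eq_zero_of_isSingularPoint_height {h : M → E p} {s : E p} {x : M}
    (hh : MDifferentiableAt (𝓡 n) (𝓡 p) h x) (hx : IsSingularPoint n (height s ∘ h) x)
    (ξ : TangentSpace (𝓡 n) x) : inner ℝ s (mfderiv (𝓡 n) (𝓡 p) h x ξ : E p) = 0 := by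
  by_contra hne
  refine hx fun (w : E 1) => ?_
  rw [((height s).hasMFDerivAt.comp x hh.hasMFDerivAt).mfderiv]
  let D : E n →L[ℝ] E p := mfderiv (𝓡 n) (𝓡 p) h x
  let u : E n := ξ
  refine ⟨(w 0 / inner ℝ s (D u)) • u, ?_⟩
  change height s (D ((w 0 / inner ℝ s (D u)) • u)) = w
  ext i
  rw [Subsingleton.elim i 0, map_smul, map_smul, height_apply]
  exact div_mul_cancel₀ _ hne

theorem isSingularPoint_of_isSingularPoint_height {h : M → E p} {s : E p} (hs : s ≠ 0) {x : M}
    (hh : MDifferentiableAt (𝓡 n) (𝓡 p) h x) (hx : IsSingularPoint n (height s ∘ h) x) :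
    IsSingularPoint n h x := by
  intro hsurj
  obtain ⟨ξ, hξ⟩ := hsurj s
  have hinner := inner_mfderiv_eq_zero_of_isSingularPoint_height hh hx ξ
  rw [hξ] at hinner
  exact hs (inner_self_eq_zero.1 hinner)

theorem IsSphericalLift.exists_height_comp (hrk : r + k = n) {h : M → E (r + 1)}
    {q : M → E (r + 1) × E k} {s : E (r + 1)} {x : M} (hq : IsSphericalLift n h q x)
    (hs : ‖s‖ = 1) (hsx : 1 ≤ inner ℝ s (h x) ^ 2) :
    ∃ q' : M → E 1 × E n, IsSphericalLift n (height s ∘ h) q' x := by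
  obtain ⟨T, hT⟩ := exists_norm_sq_eq_inner_sq_add_norm_sq hs
  have hTx : T (h x) = 0 := by
    have := hT (h x)
    rw [hq.norm_eq_one] at this
    exact norm_eq_zero.1 (pow_eq_zero_iff two_ne_zero |>.1 (by nlinarith [sq_nonneg ‖T (h x)‖]))
  let L : E (r + 1) × E k →L[ℝ] E 1 × E n :=
    (height s ∘L .fst ℝ _ _).prod
      (((splitCoords hrk).symm : E r × E k →L[ℝ] E n) ∘L T.prodMap (.id ℝ (E k)))
  refine ⟨_, hq.comp_continuousLinearMap (L := L) (fun w => ?_)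
    (hq.fst_eq.mono fun z hz => congrArg (height s) hz) ?_⟩
  · change ‖height s w.1‖ ^ 2 + ‖(splitCoords hrk).symm (T w.1, w.2)‖ ^ 2 = _
    rw [norm_sq_height, norm_sq_splitCoords_symm, hT w.1]
    ring
  · change (splitCoords hrk).symm (T (q x).1, (q x).2) = 0
    rw [hq.fst_eq.self_of_nhds, hTx, hq.snd_eq_zero]
    exact map_zero _

variable [IsManifold (𝓡 n) ∞ M]

-- The differential of `h` maps onto the orthogonal complement of `h x`, so it contains a vector
-- that differs from `s` by a multiple of `h x`.
theorem IsSphericalLift.one_le_inner_sq (hrk : r + k = n) {h : M → E (r + 1)}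
    {q : M → E (r + 1) × E k} {s : E (r + 1)} {x : M} (hq : IsSphericalLift n h q x)
    (hs : ‖s‖ = 1) (hcrit : ∀ ξ, inner ℝ s (mfderiv (𝓡 n) (𝓡 (r + 1)) h x ξ : E (r + 1)) = 0) :
    1 ≤ inner ℝ s (h x) ^ 2 := by
  obtain ⟨T, hT⟩ := exists_norm_sq_eq_inner_sq_add_norm_sq hq.norm_eq_one
  have hbij := mfderiv_bijective_of_isLocalDiffeomorphAt
    (hq.isLocalDiffeomorphAt_prodMap hT (by simp [hrk]))
  rw [((T.prodMap (.id ℝ (E k))).hasMFDerivAt.comp x hq.hasMFDerivAt).mfderiv] at hbij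
  obtain ⟨ξ, hξ⟩ := hbij.2 (T s, 0)
  let v : E (r + 1) := (mfderiv (𝓡 n) 𝓘(ℝ, E (r + 1) × E k) q x ξ : E (r + 1) × E k).1
  have hTv : T v = T s := congrArg Prod.fst hξ
  have hxv : inner ℝ (h x) v = 0 := hq.inner_fst_mfderiv_eq_zero ξ
  have hsv : inner ℝ s v = 0 := by
    have := hcrit ξ
    rw [hq.hasMFDerivAt_fst.mfderiv] at this
    exact this
  calc (1 : ℝ) ≤ ‖v‖ ^ 2 + ‖s‖ ^ 2 := by rw [hs]; nlinarith [sq_nonneg ‖v‖]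
    _ = ‖s - v‖ ^ 2 := by rw [norm_sub_sq_real, hsv]; ring
    _ = inner ℝ s (h x) ^ 2 := by
      rw [hT (s - v), map_sub, hTv, sub_self, norm_zero, inner_sub_right, hxv, real_inner_comm]
      ring

-- A critical point of a height function is a singular point of `h` at which the sphere is
-- orthogonal to `s`, so projecting the spherical lift further to the line `ℝ s` still gives a
-- spherical lift.
theorem isSpecialGenericFunction_inner {h : M → E (r + 1)} (hh : IsSpecialGeneric n h)
    (hball : ∀ x, ‖h x‖ ≤ 1) (hsphere : ∀ x, IsSingularPoint n h x → ‖h x‖ = 1)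
    {s : E (r + 1)} (hs : ‖s‖ = 1) : IsSpecialGenericFunction n fun x => inner ℝ s (h x) := by
  obtain ⟨k, hk⟩ := Nat.exists_eq_add_of_le hh.le_dim
  have hrk : r + (k + 1) = n := by omega
  have hsmooth : ContMDiff (𝓡 n) (𝓡 1) ∞ (height s ∘ h) :=
    (height s).contMDiff.comp hh.smooth
  refine ⟨le_rfl, by omega, hsmooth, fun x hx => ?_⟩
  have hhx : MDifferentiableAt (𝓡 n) (𝓡 (r + 1)) h x := hh.smooth.mdifferentiableAt (by simp)
  have hsing := isSingularPoint_of_isSingularPoint_height (norm_ne_zero_iff.1 (by simp [hs])) hhx hx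
  obtain ⟨q, hq⟩ := (hh.definite x hsing).exists_isSphericalLift hrk
    (Eventually.of_forall hball) (Eventually.of_forall hsphere)
  have hsx := hq.one_le_inner_sq hrk hs (inner_mfderiv_eq_zero_of_isSingularPoint_height hhx hx)
  obtain ⟨q', hq'⟩ := hq.exists_height_comp hrk hs hsx
  exact hq'.isDefiniteFoldPoint (zero_add n) hsmooth.continuous.continuousAt

end HeightFunctions

section MorsePerfection

variable {n p r : ℕ} {M : Type*} [TopologicalSpace M] [ChartedSpace (E n) M]

section

variable [IsManifold (𝓡 n) ∞ M]

theorem IsStandardSpecialGeneric.exists_isSpecialGeneric_norm_le_one {f : M → E p}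
    (hf : IsStandardSpecialGeneric n f) :
    ∃ h : M → E p, IsSpecialGeneric n h ∧ (∀ x, ‖h x‖ ≤ 1) ∧
      ∀ x, IsSingularPoint n h x → ‖h x‖ = 1 := by
  obtain ⟨hf, -, ι, hsmooth, hsing, F, hF, hFinj, hFι⟩ := hf
  let h : M → E p := fun x => ι (steinQuot f x)
  have hFlocal : ∀ x, IsLocalDiffeomorphAt (𝓡 p) (𝓡 p) ∞ F (h x) := fun x =>
    isLocalDiffeomorphAt_of_mfderiv_injective rfl
      (Eventually.of_forall fun _ => hF.contDiffAt.contMDiffAt)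
      (by rw [mfderiv_eq_fderiv]; exact hFinj _ (ι _).2)
  have hFh : F ∘ h = f ∘ id := funext fun x => hFι _
  have hid : ∀ x, IsLocalDiffeomorphAt (𝓡 n) (𝓡 n) ∞ (id : M → M) x :=
    (Diffeomorph.refl (𝓡 n) M ∞).isLocalDiffeomorph
  have hsing' : ∀ x, IsSingularPoint n h x ↔ IsSingularPoint n f x := fun x =>
    isSingularPoint_iff_of_eventuallyEq (hf.smooth.mdifferentiableAt (by simp))
      (hsmooth.mdifferentiableAt (by simp)) (hid x) (hFlocal x) hFh.eventuallyEq
  refine ⟨h, ⟨hf.one_le, hf.le_dim, hsmooth, fun x hx => ?_⟩,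
    fun x => mem_closedBall_zero_iff.1 (ι _).2, fun x hx => (hsing x).2 ((hsing' x).1 hx)⟩
  exact isDefiniteFoldPoint_of_eventuallyEq (hf.definite x ((hsing' x).1 hx))
    hsmooth.continuous.continuousAt (hid x) (hFlocal x) hFh.eventuallyEq

theorem hasMorseFamily_of_isSpecialGeneric {h : M → E (r + 1)} (hh : IsSpecialGeneric n h)
    (hball : ∀ x, ‖h x‖ ≤ 1) (hsphere : ∀ x, IsSingularPoint n h x → ‖h x‖ = 1) :
    HasMorseFamily n M r := by
  have := Fact.mk (@finrank_euclideanSpace_fin ℝ _ (r + 1))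
  refine ⟨fun z => inner ℝ (z.1 : E (r + 1)) (h z.2), ?_, fun s =>
    isSpecialGenericFunction_inner hh hball hsphere (mem_sphere_zero_iff_norm.1 s.2),
    fun s x => inner_neg_left _ _⟩
  have hpair : ContMDiff ((𝓡 r).prod (𝓡 n)) 𝓘(ℝ, E (r + 1) × E (r + 1)) ∞
      fun z : S r × M => ((z.1 : E (r + 1)), h z.2) :=
    (contMDiff_coe_sphere.comp contMDiff_fst).prodMk_space (hh.smooth.comp contMDiff_snd)
  have hinner : ContDiff ℝ ∞ fun z : E (r + 1) × E (r + 1) => inner ℝ z.1 z.2 := contDiff_inner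
  exact hinner.contMDiff.comp hpair

end

theorem le_morsePerfection {k : ℕ} (h : HasMorseFamily n M k) :
    ((k : ℤ) : WithTop ℤ) ≤ morsePerfection n M :=
  (WithTop.isLUB_sSup' ⟨_, Or.inl rfl⟩).1 (Or.inr ⟨k, h, rfl⟩)

theorem neg_one_le_morsePerfection : ((-1 : ℤ) : WithTop ℤ) ≤ morsePerfection n M :=
  (WithTop.isLUB_sSup' ⟨_, Or.inl rfl⟩).1 (Or.inl rfl)

theorem foldPerfection_mem_upperBounds :
    n ∈ upperBounds {p : ℕ | 1 ≤ p ∧ ∃ f : M → E p, IsStandardSpecialGeneric n f} :=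
  fun _ ⟨_, _, hf⟩ => hf.2.1.le

theorem le_foldPerfection (hp : 1 ≤ p) {f : M → E p} (hf : IsStandardSpecialGeneric n f) :
    p ≤ foldPerfection n M :=
  le_csSup ⟨n, foldPerfection_mem_upperBounds⟩ ⟨hp, f, hf⟩

theorem exists_isStandardSpecialGeneric_of_foldPerfection_eq (h : foldPerfection n M = r + 1) :
    ∃ f : M → E (r + 1), IsStandardSpecialGeneric n f := by
  have hne : {p : ℕ | 1 ≤ p ∧ ∃ f : M → E p, IsStandardSpecialGeneric n f}.Nonempty := by
    by_contra hempty
    rw [foldPerfection, not_nonempty_iff_eq_empty.1 hempty, csSup_empty] at h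
    simp at h
  exact h ▸ (Nat.sSup_mem hne ⟨n, foldPerfection_mem_upperBounds⟩).2

theorem foldPerfection_sub_one_le_morsePerfection [IsManifold (𝓡 n) ∞ M] :
    (((foldPerfection n M : ℤ) - 1 : ℤ) : WithTop ℤ) ≤ morsePerfection n M := by
  cases hp : foldPerfection n M with
  | zero => exact neg_one_le_morsePerfection
  | succ r =>
    obtain ⟨f, hf⟩ := exists_isStandardSpecialGeneric_of_foldPerfection_eq hp
    obtain ⟨h, hh, hball, hsphere⟩ := hf.exists_isSpecialGeneric_norm_le_one
    simpa using le_morsePerfection (hasMorseFamily_of_isSpecialGeneric hh hball hsphere)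

end MorsePerfection

section SphereProjection

variable {n k q r : ℕ}

/-- The projection of the sphere `S^n ⊂ ℝ^k × ℝ^q` to the last `q` coordinates, the model of a
standard special generic map. -/
def sphereProj (h : k + q = n + 1) (v : S n) : E q := (splitCoords h v).2

theorem norm_sq_fst_add_norm_sq_sphereProj (h : k + q = n + 1) (v : S n) :
    ‖(splitCoords h v).1‖ ^ 2 + ‖sphereProj h v‖ ^ 2 = 1 := by
  rw [sphereProj, ← norm_sq_eq_splitCoords, mem_sphere_zero_iff_norm.1 v.2, one_pow]

theorem fst_splitCoords_eq_zero_iff (h : k + q = n + 1) (v : S n) :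
    (splitCoords h v).1 = 0 ↔ ‖sphereProj h v‖ = 1 := by
  rw [← pow_eq_one_iff_of_nonneg (norm_nonneg (sphereProj h v)) two_ne_zero,
    eq_sub_of_add_eq' (norm_sq_fst_add_norm_sq_sphereProj h v), sub_eq_self, sq_eq_zero_iff,
    norm_eq_zero]

theorem image_coe_sphereProj_preimage (h : k + q = n + 1) (y : E q) :
    Subtype.val '' (sphereProj h ⁻¹' {y}) =
      (fun a => (splitCoords h).symm (a, y)) '' {a : E k | ‖a‖ ^ 2 = 1 - ‖y‖ ^ 2} := by
  ext v
  constructor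
  · rintro ⟨w, rfl, rfl⟩
    exact ⟨(splitCoords h w).1, eq_sub_of_add_eq (norm_sq_fst_add_norm_sq_sphereProj h w),
      (splitCoords h).symm_apply_apply _⟩
  · rintro ⟨a, ha, rfl⟩
    have hnorm : ‖(splitCoords h).symm (a, y)‖ ^ 2 = 1 := by
      rw [norm_sq_splitCoords_symm, ha, sub_add_cancel]
    refine ⟨⟨_, mem_sphere_zero_iff_norm.2
      ((pow_eq_one_iff_of_nonneg (norm_nonneg _) two_ne_zero).1 hnorm)⟩, ?_, rfl⟩
    simp [sphereProj]

theorem isPreconnected_sphereProj_preimage (h : k + q = n + 1) (hk : 2 ≤ k) (y : E q) :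
    IsPreconnected (sphereProj h ⁻¹' {y}) := by
  rw [← Topology.IsInducing.subtypeVal.isPreconnected_image, image_coe_sphereProj_preimage]
  refine IsPreconnected.image ?_ _ (by fun_prop)
  rcases lt_or_ge (1 - ‖y‖ ^ 2) 0 with hy | hy
  · convert isPreconnected_empty
    exact eq_empty_of_forall_notMem fun a ha => hy.not_ge (ha ▸ sq_nonneg ‖a‖)
  · have hset : {a : E k | ‖a‖ ^ 2 = 1 - ‖y‖ ^ 2} = Metric.sphere 0 (√(1 - ‖y‖ ^ 2)) := by
      ext a
      rw [mem_sphere_zero_iff_norm, eq_comm (a := ‖a‖), Real.sqrt_eq_iff_eq_sq hy (norm_nonneg _)]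
      exact eq_comm
    rw [hset]
    refine isPreconnected_sphere ?_ _ _
    rw [← finrank_eq_rank, finrank_euclideanSpace_fin]
    exact_mod_cast hk

theorem range_sphereProj [NeZero k] (h : k + q = n + 1) :
    range (sphereProj h) = Metric.closedBall 0 1 := by
  ext y
  rw [mem_closedBall_zero_iff, ← sq_le_one_iff₀ (norm_nonneg y)]
  constructor
  · rintro ⟨v, rfl⟩
    have := norm_sq_fst_add_norm_sq_sphereProj h v
    nlinarith [sq_nonneg ‖(splitCoords h v).1‖]
  · intro hy
    let a : E k := EuclideanSpace.single 0 (√(1 - ‖y‖ ^ 2))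
    have ha : a ∈ {a : E k | ‖a‖ ^ 2 = 1 - ‖y‖ ^ 2} := by simp [a, Real.sq_sqrt (sub_nonneg.2 hy)]
    obtain ⟨v, hv, -⟩ := (image_coe_sphereProj_preimage h y).ge (mem_image_of_mem _ ha)
    exact ⟨v, hv⟩

theorem contMDiff_sphereProj (h : k + q = n + 1) : ContMDiff (𝓡 n) (𝓡 q) ∞ (sphereProj h) := by
  have := Fact.mk (@finrank_euclideanSpace_fin ℝ _ (n + 1))
  exact (ContinuousLinearMap.snd ℝ (E k) (E q) ∘L
    (splitCoords h : E (n + 1) →L[ℝ] E k × E q)).contMDiff.comp contMDiff_coe_sphere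

theorem isSphericalLift_sphereProj (h : k + q = n + 1) {v : S n} (hv : ‖sphereProj h v‖ = 1) :
    IsSphericalLift n (sphereProj h) (fun w : S n => (splitCoords h w).swap) v := by
  have := Fact.mk (@finrank_euclideanSpace_fin ℝ _ (n + 1))
  let L : E (n + 1) ≃L[ℝ] E q × E k := (splitCoords h).trans (.prodComm ℝ (E k) (E q))
  refine ⟨Eventually.of_forall fun w => (L : E (n + 1) →L[ℝ] E q × E k).contMDiff.contMDiffAt.comp w
    contMDiff_coe_sphere.contMDiffAt, Eventually.of_forall fun _ => rfl,
    Eventually.of_forall fun w => (add_comm _ _).trans (norm_sq_fst_add_norm_sq_sphereProj h w),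
    (fst_splitCoords_eq_zero_iff h v).2 hv, ?_⟩
  have hderiv := (L : E (n + 1) →L[ℝ] E q × E k).hasMFDerivAt.comp v
    (contMDiff_coe_sphere (n := n) (m := 1).mdifferentiableAt one_ne_zero).hasMFDerivAt
  change Function.Injective
    (mfderiv (𝓡 n) 𝓘(ℝ, E q × E k) ((L : E (n + 1) →L[ℝ] E q × E k) ∘ Subtype.val) v)
  rw [hderiv.mfderiv]
  exact L.injective.comp (injective_mvfderiv_subtypeVal_sphere v)

-- If `a`, the vector of the first coordinates of `v`, is not zero, then `(c • a, w)` is tangent to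
-- the sphere at `v` for a suitable `c`.
theorem surjective_mfderiv_sphereProj (h : k + q = n + 1) {v : S n}
    (hv : (splitCoords h v).1 ≠ 0) :
    Function.Surjective (mfderiv (𝓡 n) (𝓡 q) (sphereProj h) v) := by
  intro (w : E q)
  have := Fact.mk (@finrank_euclideanSpace_fin ℝ _ (n + 1))
  let a := (splitCoords h v).1
  let u : E (n + 1) :=
    (splitCoords h).symm (-(inner ℝ (sphereProj h v) w / ‖a‖ ^ 2) • a, w)
  have hu : u ∈ (ℝ ∙ (v : E (n + 1)))ᗮ := by
    rw [Submodule.mem_orthogonal_singleton_iff_inner_right, inner_eq_splitCoords h,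
      ContinuousLinearEquiv.apply_symm_apply, inner_smul_right, real_inner_self_eq_norm_sq]
    have ha : ‖a‖ ^ 2 ≠ 0 := pow_ne_zero _ (norm_ne_zero_iff.2 hv)
    change -(inner ℝ (sphereProj h v) w / ‖a‖ ^ 2) * ‖a‖ ^ 2 + inner ℝ (sphereProj h v) w = 0
    rw [neg_mul, div_mul_cancel₀ _ ha, neg_add_cancel]
  rw [← range_mvfderiv_subtypeVal (n := n) v] at hu
  obtain ⟨ξ, hξ⟩ := hu
  refine ⟨ξ, ?_⟩
  let L := ContinuousLinearMap.snd ℝ (E k) (E q) ∘L (splitCoords h : E (n + 1) →L[ℝ] E k × E q)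
  have hderiv := L.hasMFDerivAt.comp v
    (contMDiff_coe_sphere (n := n) (m := 1).mdifferentiableAt one_ne_zero).hasMFDerivAt
  change mfderiv (𝓡 n) 𝓘(ℝ, E q) (L ∘ Subtype.val) v ξ = w
  rw [hderiv.mfderiv]
  refine (congrArg L hξ).trans ?_
  simp [L, u]

theorem isSingularPoint_sphereProj_iff (h : k + q = n + 1) {v : S n} :
    IsSingularPoint n (sphereProj h) v ↔ ‖sphereProj h v‖ = 1 := by
  refine ⟨fun hv => ?_, fun hv => (isSphericalLift_sphereProj h hv).not_surjective_mfderiv⟩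
  rw [← fst_splitCoords_eq_zero_iff]
  exact not_not.1 fun hne => hv (surjective_mfderiv_sphereProj h hne)

theorem isSpecialGeneric_sphereProj (h : k + (r + 1) = n + 1) (hk : k ≠ 0) :
    IsSpecialGeneric n (sphereProj h) where
  one_le := by omega
  le_dim := by omega
  smooth := contMDiff_sphereProj h
  definite _ hv :=
    (isSphericalLift_sphereProj h ((isSingularPoint_sphereProj_iff h).1 hv)).isDefiniteFoldPoint
      (by omega) (contMDiff_sphereProj h).continuous.continuousAt

end SphereProjection

section SteinSpace

variable {X Y : Type*} [TopologicalSpace X] [CompactSpace X] [TopologicalSpace Y] [T2Space Y]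

theorem exists_homeomorph_steinSpace {f : X → Y} (hf : Continuous f)
    (hfib : ∀ y, IsPreconnected (f ⁻¹' {y})) {s : Set Y} (hrange : range f = s) :
    ∃ ι : SteinSpace f ≃ₜ s, ∀ w, (ι w : Y) = steinMap f w := by
  subst hrange
  let g : SteinSpace f → range f :=
    Quotient.lift (rangeFactorization f) fun _ _ h => Subtype.ext h.1
  have hinj : Function.Injective g := by
    rintro ⟨x₁⟩ ⟨x₂⟩ h
    have hx : f x₁ = f x₂ := congrArg Subtype.val h
    exact Quotient.sound
      ⟨hx, (hfib (f x₁)).subset_connectedComponentIn rfl subset_rfl hx.symm⟩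
  have hsurj : Function.Surjective g := fun ⟨_, x, hx⟩ => ⟨steinQuot f x, Subtype.ext hx⟩
  refine ⟨Continuous.homeoOfEquivCompactToT2 (f := Equiv.ofBijective g ⟨hinj, hsurj⟩)
    ((hf.subtype_mk _).quotient_lift _), ?_⟩
  rintro ⟨x⟩
  rfl

end SteinSpace

section FibrewiseEquivalence

variable {n p : ℕ} {M N : Type*} [TopologicalSpace M] [ChartedSpace (E n) M]
  [TopologicalSpace N] [ChartedSpace (E n) N]

variable (n) in
/-- Each fibre of `f` lies in an open set that is diffeomorphic to an open set of `N` containing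
the corresponding fibre of `f₀`, by a diffeomorphism that carries `f₀` to `f`. -/
def IsFibrewiseEquivalent (f₀ : N → E p) (f : M → E p) : Prop :=
  ∀ y, ∃ κ : OpenPartialHomeomorph N M,
    ContMDiffOn (𝓡 n) (𝓡 n) ∞ κ κ.source ∧ ContMDiffOn (𝓡 n) (𝓡 n) ∞ κ.symm κ.target ∧
    (∀ v ∈ κ.source, f (κ v) = f₀ v) ∧ f₀ ⁻¹' {y} ⊆ κ.source ∧ f ⁻¹' {y} ⊆ κ.target

namespace IsFibrewiseEquivalent

variable {f₀ : N → E p} {f : M → E p}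

theorem exists_isLocalDiffeomorphAt (h : IsFibrewiseEquivalent n f₀ f) (x : M) :
    ∃ g : M → N, IsLocalDiffeomorphAt (𝓡 n) (𝓡 n) ∞ g x ∧ f =ᶠ[𝓝 x] f₀ ∘ g := by
  obtain ⟨κ, hκ, hκ', hfκ, -, htarget⟩ := h (f x)
  have hx : x ∈ κ.target := htarget rfl
  refine ⟨κ.symm, isLocalDiffeomorphAt_of_contMDiffOn κ.symm hκ' (by simpa using hκ) hx, ?_⟩
  filter_upwards [κ.open_target.mem_nhds hx] with z hz
  rw [Function.comp_apply, ← hfκ _ (κ.map_target hz), κ.right_inv hz]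

theorem image_preimage (h : IsFibrewiseEquivalent n f₀ f) (y : E p) :
    ∃ κ : N → M, ContinuousOn κ (f₀ ⁻¹' {y}) ∧ κ '' (f₀ ⁻¹' {y}) = f ⁻¹' {y} := by
  obtain ⟨κ, -, -, hfκ, hsource, htarget⟩ := h y
  refine ⟨κ, κ.continuousOn.mono hsource, Subset.antisymm ?_ fun x hx => ?_⟩
  · rintro _ ⟨v, hv, rfl⟩
    exact (hfκ v (hsource hv)).trans hv
  · refine ⟨κ.symm x, ?_, κ.right_inv (htarget hx)⟩
    rw [mem_preimage, ← hfκ _ (κ.map_target (htarget hx)), κ.right_inv (htarget hx)]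
    exact hx

theorem isPreconnected_preimage (h : IsFibrewiseEquivalent n f₀ f) {y : E p}
    (hy : IsPreconnected (f₀ ⁻¹' {y})) : IsPreconnected (f ⁻¹' {y}) := by
  obtain ⟨κ, hκ, himage⟩ := h.image_preimage y
  exact himage ▸ hy.image κ hκ

theorem range_eq (h : IsFibrewiseEquivalent n f₀ f) : range f = range f₀ := by
  ext y
  obtain ⟨κ, -, himage⟩ := h.image_preimage y
  rw [← preimage_singleton_nonempty, ← preimage_singleton_nonempty, ← himage, image_nonempty]

theorem contMDiff (h : IsFibrewiseEquivalent n f₀ f) (hf₀ : ContMDiff (𝓡 n) (𝓡 p) ∞ f₀) :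
    ContMDiff (𝓡 n) (𝓡 p) ∞ f := fun x => by
  obtain ⟨g, hg, hfg⟩ := h.exists_isLocalDiffeomorphAt x
  exact (hf₀.contMDiffAt.comp x hg.contMDiffAt).congr_of_eventuallyEq hfg

theorem isSingularPoint_iff (h : IsFibrewiseEquivalent n f₀ f)
    (hf₀ : ContMDiff (𝓡 n) (𝓡 p) ∞ f₀) {P : E p → Prop}
    (hP : ∀ v, IsSingularPoint n f₀ v ↔ P (f₀ v)) (x : M) : IsSingularPoint n f x ↔ P (f x) := by
  obtain ⟨g, hg, hfg⟩ := h.exists_isLocalDiffeomorphAt x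
  rw [isSingularPoint_iff_of_eventuallyEq (hf₀.mdifferentiableAt (by simp))
    ((h.contMDiff hf₀).mdifferentiableAt (by simp)) hg
    ((Diffeomorph.refl (𝓡 p) (E p) ∞).isLocalDiffeomorph (f x)) hfg, hP, hfg.self_of_nhds,
    Function.comp_apply]

variable [IsManifold (𝓡 n) ∞ M]

theorem isSpecialGeneric (h : IsFibrewiseEquivalent n f₀ f) (hf₀ : IsSpecialGeneric n f₀) :
    IsSpecialGeneric n f where
  one_le := hf₀.one_le
  le_dim := hf₀.le_dim
  smooth := h.contMDiff hf₀.smooth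
  definite x hx := by
    obtain ⟨g, hg, hfg⟩ := h.exists_isLocalDiffeomorphAt x
    have hrefl := (Diffeomorph.refl (𝓡 p) (E p) ∞).isLocalDiffeomorph (f x)
    have hf := h.contMDiff hf₀.smooth
    refine isDefiniteFoldPoint_of_eventuallyEq (hf₀.definite _ ?_) hf.continuous.continuousAt hg
      hrefl hfg
    exact (isSingularPoint_iff_of_eventuallyEq (hf₀.smooth.mdifferentiableAt (by simp))
      (hf.mdifferentiableAt (by simp)) hg hrefl hfg).1 hx

end IsFibrewiseEquivalent

theorem IsSpecialGeneric.isStandardSpecialGeneric [CompactSpace M] {f : M → E p}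
    (hf : IsSpecialGeneric n f) (hp : p < n)
    (hsing : ∀ x, IsSingularPoint n f x ↔ ‖f x‖ = 1) (hrange : range f = Metric.closedBall 0 1)
    (hfib : ∀ y, IsPreconnected (f ⁻¹' {y})) : IsStandardSpecialGeneric n f := by
  obtain ⟨ι, hι⟩ := exists_homeomorph_steinSpace hf.smooth.continuous hfib hrange
  have hιf (x : M) : (ι (steinQuot f x) : E p) = f x := hι _
  refine ⟨hf, hp, ι, ?_, fun x => ?_, id, contDiff_id, fun y _ => ?_, hι⟩
  · simpa only [hιf] using hf.smooth
  · rw [hιf, hsing]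
  · rw [fderiv_id]
    exact Function.injective_id

end FibrewiseEquivalence

section SphereExtension

variable {m : ℕ}

theorem hemi_apply_succ (ε : ℝ) (x : E m) (i : Fin m) : hemi ε x i.succ = x i := rfl

theorem exists_eq_hemi (z : S m) :
    ∃ x : E m, ‖x‖ ≤ 1 ∧ (∀ i, x i = (z : E (m + 1)) i.succ) ∧
      ((z : E (m + 1)) = hemi (-1) x ∨ (z : E (m + 1)) = hemi 1 x) := by
  let t := (z : E (m + 1)) 0
  let x : E m := WithLp.toLp 2 fun i => (z : E (m + 1)) i.succ
  have hnorm : t ^ 2 + ‖x‖ ^ 2 = 1 := by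
    rw [EuclideanSpace.real_norm_sq_eq, ← Fin.sum_univ_succ fun i => (z : E (m + 1)) i ^ 2,
      ← EuclideanSpace.real_norm_sq_eq, mem_sphere_zero_iff_norm.1 z.2, one_pow]
  have hhemi {ε : ℝ} (hε : ε * |t| = t) : (z : E (m + 1)) = hemi ε x := by
    ext i
    cases i using Fin.cases with
    | zero =>
      rw [← Real.sqrt_sq_eq_abs, eq_sub_of_add_eq hnorm] at hε
      exact hε.symm
    | succ i => rfl
  refine ⟨x, ?_, fun _ => rfl, ?_⟩
  · rw [← sq_le_one_iff₀ (norm_nonneg x)]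
    linarith [sq_nonneg t]
  · rcases le_total t 0 with ht | ht
    · exact Or.inl (hhemi (by rw [abs_of_nonpos ht, neg_one_mul, neg_neg]))
    · exact Or.inr (hhemi (by rw [abs_of_nonneg ht, one_mul]))

theorem IsSphereExtension.apply_succ {g : E m ≃ₘ^∞⟮𝓡 m, 𝓡 m⟯ E m} {φ : S m ≃ₘ^∞⟮𝓡 m, 𝓡 m⟯ S m}
    (hφ : IsSphereExtension g φ) {i : Fin m} (hg : ∀ x : E m, ‖x‖ ≤ 1 → g x i = x i) (z : S m) :
    (φ z : E (m + 1)) i.succ = (z : E (m + 1)) i.succ := by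
  obtain ⟨x, hx, hxz, hz | hz⟩ := exists_eq_hemi z
  · rw [(hφ x hx z).1 hz, hemi_apply_succ, hg x hx, hxz]
  · rw [(hφ x hx z).2 hz]

end SphereExtension

section Cylinder

variable {m k r : ℕ}

theorem norm_sq_eq_initLast (y : E (r + 1)) :
    ‖y‖ ^ 2 = ‖(initLast r y).1‖ ^ 2 + (initLast r y).2 ^ 2 := by
  simp only [EuclideanSpace.real_norm_sq_eq, Fin.sum_univ_castSucc, initLast_fst_apply,
    initLast_snd]

theorem initLast_cyl (z : S m) (t : Icc (-1 : ℝ) 1) :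
    initLast (m + 1) (cyl z t) = (√(1 - (t : ℝ) ^ 2) • (z : E (m + 1)), (t : ℝ)) := by
  ext <;> simp [initLast_fst_apply, initLast_snd, cyl]

theorem cyl_apply_last (z : S m) (t : Icc (-1 : ℝ) 1) :
    (cyl z t : E (m + 2)) (Fin.last (m + 1)) = t :=
  congrArg Prod.snd (initLast_cyl z t)

theorem cyl_apply_castSucc (z : S m) (t : Icc (-1 : ℝ) 1) (i : Fin (m + 1)) :
    (cyl z t : E (m + 2)) i.castSucc = √(1 - (t : ℝ) ^ 2) * (z : E (m + 1)) i :=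
  congrArg (fun w => w.1 i) (initLast_cyl z t)

theorem exists_eq_cyl {v : S (m + 1)} (hone : (v : E (m + 2)) (Fin.last (m + 1)) ≠ 1)
    (hneg : (v : E (m + 2)) (Fin.last (m + 1)) ≠ -1) :
    ∃ (z : S m) (t : Icc (-1 : ℝ) 1), (t : ℝ) ∈ Ioo (-1 : ℝ) 1 ∧ v = cyl z t := by
  obtain ⟨a, t, hat⟩ : ∃ a t, initLast (m + 1) v = (a, t) := ⟨_, _, rfl⟩
  obtain rfl : (v : E (m + 2)) (Fin.last (m + 1)) = t := congrArg Prod.snd hat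
  set t := (v : E (m + 2)) (Fin.last (m + 1))
  have hnorm : ‖a‖ ^ 2 + t ^ 2 = 1 := by
    have := norm_sq_eq_initLast (v : E (m + 2))
    rw [mem_sphere_zero_iff_norm.1 v.2, one_pow, hat] at this
    exact this.symm
  have hlt : 0 < 1 - t ^ 2 := (by linarith [sq_nonneg ‖a‖] : 0 ≤ 1 - t ^ 2).lt_of_ne'
    (sub_ne_zero.2 fun h => (sq_eq_one_iff.1 h.symm).elim hone hneg)
  have hIoo : t ∈ Ioo (-1 : ℝ) 1 := abs_lt.1 ((sq_lt_one_iff_abs_lt_one t).1 (sub_pos.1 hlt))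
  have hsqrt : √(1 - t ^ 2) = ‖a‖ := by
    rw [← eq_sub_of_add_eq hnorm, Real.sqrt_sq (norm_nonneg a)]
  have ha : ‖a‖ ≠ 0 := hsqrt ▸ (Real.sqrt_pos.2 hlt).ne'
  refine ⟨⟨‖a‖⁻¹ • a, ?_⟩, ⟨t, Ioo_subset_Icc_self hIoo⟩, hIoo, Subtype.ext ?_⟩
  · rw [mem_sphere_zero_iff_norm, norm_smul, norm_inv, norm_norm, inv_mul_cancel₀ ha]
  · refine (initLast (m + 1)).injective ?_
    rw [initLast_cyl, hat, hsqrt, smul_inv_smul₀ ha]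

theorem sphereProj_apply_last {n : ℕ} (h : k + (r + 1) = n + 1) (v : S n) :
    sphereProj h v (Fin.last r) = (v : E (n + 1)) (Fin.last n) := by
  rw [sphereProj, splitCoords_snd_apply]
  refine congrArg (fun j => (v : E (n + 1)) j) (Fin.ext ?_)
  simp only [Fin.val_cast, Fin.val_natAdd, Fin.val_last]
  omega

theorem sphereProj_cyl_eq (h : k + 1 + (r + 1) = m + 1 + 1) {φ : S m → S m}
    (hφ : ∀ i : Fin m, k ≤ i → ∀ z, (φ z : E (m + 1)) i.succ = (z : E (m + 1)) i.succ)
    (z : S m) (t : Icc (-1 : ℝ) 1) : sphereProj h (cyl (φ z) t) = sphereProj h (cyl z t) := by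
  ext i
  cases i using Fin.lastCases with
  | last => simp only [sphereProj_apply_last, cyl_apply_last]
  | cast i =>
    have hi : Fin.cast h (Fin.natAdd (k + 1) i.castSucc) =
        Fin.castSucc (Fin.succ ⟨k + i, by omega⟩) := Fin.ext (by simp; omega)
    rw [sphereProj, sphereProj, splitCoords_snd_apply, splitCoords_snd_apply, hi,
      cyl_apply_castSucc, cyl_apply_castSucc, hφ _ (Nat.le_add_right k i)]

end Cylinder

section TwistedSphere

variable {m : ℕ} {M Y : Type*} [TopologicalSpace M]

/-- The embeddings `kminus` and `kplus` of the sphere without the north pole, respectively the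
south pole, present the space `M` as a twisted sphere of `φ`, as in `IsTwistedSphere`, but without
any condition of smoothness. -/
structure IsTwistedDecomposition (φ : S m ≃ S m)
    (kminus kplus : OpenPartialHomeomorph (S (m + 1)) M) : Prop where
  source_minus : kminus.source = {v : S (m + 1) | (v : E (m + 2)) (Fin.last (m + 1)) ≠ 1}
  source_plus : kplus.source = {v : S (m + 1) | (v : E (m + 2)) (Fin.last (m + 1)) ≠ -1}
  union_target : kminus.target ∪ kplus.target = univ
  inter_target : kminus.target ∩ kplus.target = kminus '' (kminus.source ∩ kplus.source)
  minus_cyl_eq : ∀ (z : S m) (t : Icc (-1 : ℝ) 1), (t : ℝ) ∈ Ioo (-1 : ℝ) 1 →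
    kminus (cyl z t) = kplus (cyl (φ z) t)

namespace IsTwistedDecomposition

variable {φ : S m ≃ S m} {kminus kplus : OpenPartialHomeomorph (S (m + 1)) M}

theorem mem_source_minus (h : IsTwistedDecomposition φ kminus kplus) {v : S (m + 1)} :
    v ∈ kminus.source ↔ (v : E (m + 2)) (Fin.last (m + 1)) ≠ 1 :=
  h.source_minus ▸ Iff.rfl

theorem mem_source_plus (h : IsTwistedDecomposition φ kminus kplus) {v : S (m + 1)} :
    v ∈ kplus.source ↔ (v : E (m + 2)) (Fin.last (m + 1)) ≠ -1 :=
  h.source_plus ▸ Iff.rfl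

theorem exists_plus_eq_minus (h : IsTwistedDecomposition φ kminus kplus) {F : S (m + 1) → Y}
    (hF : ∀ z t, F (cyl (φ z) t) = F (cyl z t)) {v : S (m + 1)} (hminus : v ∈ kminus.source)
    (hplus : v ∈ kplus.source) : ∃ w ∈ kplus.source, kplus w = kminus v ∧ F w = F v := by
  obtain ⟨z, t, ht, rfl⟩ := exists_eq_cyl (h.mem_source_minus.1 hminus) (h.mem_source_plus.1 hplus)
  refine ⟨cyl (φ z) t, ?_, (h.minus_cyl_eq z t ht).symm, hF z t⟩
  rw [h.mem_source_plus, cyl_apply_last]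
  exact ht.1.ne'

theorem exists_minus_eq_plus (h : IsTwistedDecomposition φ kminus kplus) {F : S (m + 1) → Y}
    (hF : ∀ z t, F (cyl (φ z) t) = F (cyl z t)) {v : S (m + 1)} (hminus : v ∈ kminus.source)
    (hplus : v ∈ kplus.source) : ∃ w ∈ kminus.source, kminus w = kplus v ∧ F w = F v := by
  obtain ⟨z, t, ht, rfl⟩ := exists_eq_cyl (h.mem_source_minus.1 hminus) (h.mem_source_plus.1 hplus)
  refine ⟨cyl (φ.symm z) t, ?_, ?_, ?_⟩
  · rw [h.mem_source_minus, cyl_apply_last]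
    exact ht.2.ne
  · rw [h.minus_cyl_eq _ t ht, φ.apply_symm_apply]
  · rw [← hF, φ.apply_symm_apply]

theorem exists_eqOn_comp (h : IsTwistedDecomposition φ kminus kplus) {F : S (m + 1) → Y}
    (hF : ∀ z t, F (cyl (φ z) t) = F (cyl z t)) :
    ∃ f : M → Y, EqOn (f ∘ kminus) F kminus.source ∧ EqOn (f ∘ kplus) F kplus.source := by
  classical
  refine ⟨fun x => if x ∈ kminus.target then F (kminus.symm x) else F (kplus.symm x),
    fun v hv => ?_, fun v hv => ?_⟩
  · simp only [Function.comp_apply, if_pos (kminus.map_source hv), kminus.left_inv hv]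
  · by_cases hx : kplus v ∈ kminus.target
    · obtain ⟨w, ⟨hminus, hplus⟩, hwv⟩ := h.inter_target.le ⟨hx, kplus.map_source hv⟩
      obtain ⟨w', hw', hw'w, hFw⟩ := h.exists_plus_eq_minus hF hminus hplus
      obtain rfl : w' = v := kplus.injOn hw' hv (hw'w.trans hwv)
      simp only [Function.comp_apply, if_pos hx]
      rw [← hwv, kminus.left_inv hminus, hFw]
    · simp only [Function.comp_apply, if_neg hx, kplus.left_inv hv]

theorem compactSpace (h : IsTwistedDecomposition φ kminus kplus) : CompactSpace M := by
  let ℓ (v : S (m + 1)) : ℝ := (v : E (m + 2)) (Fin.last (m + 1))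
  have hℓ : Continuous ℓ := by fun_prop
  have hcyl (z : S m) (t : Icc (-1 : ℝ) 1) : ℓ (cyl (φ z) t) = ℓ (cyl z t) :=
    (cyl_apply_last _ t).trans (cyl_apply_last z t).symm
  have hminus {v : S (m + 1)} (hv : ℓ v ≤ 0) : v ∈ kminus.source :=
    h.mem_source_minus.2 (hv.trans_lt one_pos).ne
  have hplus {v : S (m + 1)} (hv : 0 ≤ ℓ v) : v ∈ kplus.source :=
    h.mem_source_plus.2 ((neg_lt_zero.2 one_pos).trans_le hv).ne'
  have hcover : kminus '' {v | ℓ v ≤ 0} ∪ kplus '' {v | 0 ≤ ℓ v} = univ := by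
    refine eq_univ_of_forall fun x => ?_
    rcases h.union_target.ge (mem_univ x) with hx | hx
    · rw [← kminus.right_inv hx]
      rcases le_total (ℓ (kminus.symm x)) 0 with hle | hge
      · exact Or.inl (mem_image_of_mem _ hle)
      · obtain ⟨w, -, hw, hℓw⟩ := h.exists_plus_eq_minus hcyl (kminus.map_target hx) (hplus hge)
        exact Or.inr ⟨w, hℓw.ge.trans' hge, hw⟩
    · rw [← kplus.right_inv hx]
      rcases le_total 0 (ℓ (kplus.symm x)) with hge | hle
      · exact Or.inr (mem_image_of_mem _ hge)
      · obtain ⟨w, -, hw, hℓw⟩ := h.exists_minus_eq_plus hcyl (hminus hle) (kplus.map_target hx)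
        exact Or.inl ⟨w, hℓw.le.trans hle, hw⟩
  refine ⟨hcover ▸ IsCompact.union ?_ ?_⟩
  · exact (isClosed_le hℓ continuous_const).isCompact.image_of_continuousOn
      (kminus.continuousOn.mono fun _ => hminus)
  · exact (isClosed_le continuous_const hℓ).isCompact.image_of_continuousOn
      (kplus.continuousOn.mono fun _ => hplus)

section Fibres

variable {F : S (m + 1) → Y} {f : M → Y} {ℓ : Y → ℝ}

theorem preimage_subset_target_minus (h : IsTwistedDecomposition φ kminus kplus)
    (hF : ∀ z t, F (cyl (φ z) t) = F (cyl z t))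
    (hℓ : ∀ v, ℓ (F v) = (v : E (m + 2)) (Fin.last (m + 1)))
    (hf : EqOn (f ∘ kplus) F kplus.source) {y : Y} (hy : ℓ y ≠ 1) :
    f ⁻¹' {y} ⊆ kminus.target := by
  rintro x rfl
  refine (h.union_target.ge (mem_univ x)).elim id fun hx => ?_
  have hv := kplus.map_target hx
  have hne : kplus.symm x ∈ kminus.source := by
    rwa [h.mem_source_minus, ← hℓ, ← hf hv, Function.comp_apply, kplus.right_inv hx]
  obtain ⟨w, hw, hwx, -⟩ := h.exists_minus_eq_plus hF hne hv
  rw [← kplus.right_inv hx, ← hwx]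
  exact kminus.map_source hw

theorem preimage_subset_target_plus (h : IsTwistedDecomposition φ kminus kplus)
    (hF : ∀ z t, F (cyl (φ z) t) = F (cyl z t))
    (hℓ : ∀ v, ℓ (F v) = (v : E (m + 2)) (Fin.last (m + 1)))
    (hf : EqOn (f ∘ kminus) F kminus.source) {y : Y} (hy : ℓ y ≠ -1) :
    f ⁻¹' {y} ⊆ kplus.target := by
  rintro x rfl
  refine (h.union_target.ge (mem_univ x)).elim (fun hx => ?_) id
  have hv := kminus.map_target hx
  have hne : kminus.symm x ∈ kplus.source := by
    rwa [h.mem_source_plus, ← hℓ, ← hf hv, Function.comp_apply, kminus.right_inv hx]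
  obtain ⟨w, hw, hwx, -⟩ := h.exists_plus_eq_minus hF hv hne
  rw [← kminus.right_inv hx, ← hwx]
  exact kplus.map_source hw

end Fibres

theorem isFibrewiseEquivalent {p : ℕ} [ChartedSpace (E (m + 1)) M]
    (h : IsTwistedDecomposition φ kminus kplus)
    (hminus : ContMDiffOn (𝓡 (m + 1)) (𝓡 (m + 1)) ∞ kminus kminus.source)
    (hminus_symm : ContMDiffOn (𝓡 (m + 1)) (𝓡 (m + 1)) ∞ kminus.symm kminus.target)
    (hplus : ContMDiffOn (𝓡 (m + 1)) (𝓡 (m + 1)) ∞ kplus kplus.source)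
    (hplus_symm : ContMDiffOn (𝓡 (m + 1)) (𝓡 (m + 1)) ∞ kplus.symm kplus.target)
    {F : S (m + 1) → E p} (hF : ∀ z t, F (cyl (φ z) t) = F (cyl z t))
    {ℓ : E p → ℝ} (hℓ : ∀ v, ℓ (F v) = (v : E (m + 2)) (Fin.last (m + 1)))
    {f : M → E p} (hf_minus : EqOn (f ∘ kminus) F kminus.source)
    (hf_plus : EqOn (f ∘ kplus) F kplus.source) : IsFibrewiseEquivalent (m + 1) F f := by
  intro y
  by_cases hy : ℓ y = 1
  · have hne : ℓ y ≠ -1 := by rw [hy]; norm_num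
    refine ⟨kplus, hplus, hplus_symm, hf_plus, ?_,
      h.preimage_subset_target_plus hF hℓ hf_minus hne⟩
    rintro v rfl
    rwa [h.mem_source_plus, ← hℓ]
  · refine ⟨kminus, hminus, hminus_symm, hf_minus, ?_,
      h.preimage_subset_target_minus hF hℓ hf_plus hy⟩
    rintro v rfl
    rwa [h.mem_source_minus, ← hℓ]

end IsTwistedDecomposition

end TwistedSphere

section GromollFiltration

variable {m r : ℕ} {M : Type*} [TopologicalSpace M] [ChartedSpace (E (m + 1)) M]
  [IsManifold (𝓡 (m + 1)) ∞ M]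

theorem exists_isStandardSpecialGeneric_of_isInGromollGroup (hr : r < m)
    (h : IsInGromollGroup m M (r + 1)) :
    ∃ f : M → E (r + 1), IsStandardSpecialGeneric (m + 1) f := by
  obtain ⟨g, φ, -, hg, hφ, kminus, kplus, hsource_minus, hsource_plus, hminus, hminus_symm, hplus,
    hplus_symm, hunion, hinter, hglue⟩ := h
  have hdec : IsTwistedDecomposition φ.toEquiv kminus kplus :=
    ⟨hsource_minus, hsource_plus, hunion, hinter, hglue⟩
  have := hdec.compactSpace
  have hsum : m - r + 1 + (r + 1) = m + 1 + 1 := by omega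
  have hF := sphereProj_cyl_eq hsum (φ := φ.toEquiv) fun i hi =>
    hφ.apply_succ fun x hx => hg x hx i hi
  obtain ⟨f, hf_minus, hf_plus⟩ := hdec.exists_eqOn_comp hF
  have hf := hdec.isFibrewiseEquivalent hminus hminus_symm hplus hplus_symm hF
    (ℓ := fun y => y (Fin.last r)) (sphereProj_apply_last hsum) hf_minus hf_plus
  have hproj := isSpecialGeneric_sphereProj hsum (Nat.succ_ne_zero _)
  exact ⟨f, (hf.isSpecialGeneric hproj).isStandardSpecialGeneric (by omega)
    (hf.isSingularPoint_iff hproj.smooth (P := fun y => ‖y‖ = 1) fun _ =>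
      isSingularPoint_sphereProj_iff hsum)
    (hf.range_eq.trans (range_sphereProj hsum)) fun y =>
      hf.isPreconnected_preimage (isPreconnected_sphereProj_preimage hsum (by omega) y)⟩

variable (m M) in
theorem gromollFiltration_le_foldPerfection : gromollFiltration m M ≤ foldPerfection (m + 1) M := by
  rcases eq_empty_or_nonempty {q : ℕ | 1 ≤ q ∧ q ≤ m ∧ IsInGromollGroup m M q} with h | h
  · simp [gromollFiltration, h]
  · obtain ⟨hone, hle, hq⟩ := Nat.sSup_mem h ⟨m, fun q hq => hq.2.1⟩
    rw [← gromollFiltration] at hone hle hq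
    obtain ⟨r, hr⟩ := Nat.exists_eq_add_of_le' hone
    rw [hr] at hle hq ⊢
    obtain ⟨f, hf⟩ := exists_isStandardSpecialGeneric_of_isInGromollGroup hle hq
    exact le_foldPerfection (Nat.le_add_left 1 r) hf

end GromollFiltration

end

end FoldPerfection

theorem mainTheorem1_general (m : ℕ) (M : Type*) [TopologicalSpace M]
    [ChartedSpace (EuclideanSpace ℝ (Fin (m + 1))) M] [IsManifold (𝓡 (m + 1)) ∞ M] :
    FoldPerfection.gromollFiltration m M ≤ FoldPerfection.foldPerfection (m + 1) M ∧
    (((FoldPerfection.foldPerfection (m + 1) M : ℤ) - 1 : ℤ) : WithTop ℤ) ≤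
      FoldPerfection.morsePerfection (m + 1) M :=
  ⟨FoldPerfection.gromollFiltration_le_foldPerfection m M,
    FoldPerfection.foldPerfection_sub_one_le_morsePerfection⟩

theorem mainTheorem1 (m : ℕ) (hm : 7 ≤ m + 1)
    (M : Type*) [TopologicalSpace M] [T2Space M] [CompactSpace M]
    [ChartedSpace (EuclideanSpace ℝ (Fin (m + 1))) M] [IsManifold (𝓡 (m + 1)) ∞ M]
    (hM : Nonempty (ContinuousMap.HomotopyEquiv M
      (Metric.sphere (0 : EuclideanSpace ℝ (Fin (m + 1 + 1))) 1))) :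
    FoldPerfection.gromollFiltration m M ≤ FoldPerfection.foldPerfection (m + 1) M ∧
    (((FoldPerfection.foldPerfection (m + 1) M : ℤ) - 1 : ℤ) : WithTop ℤ) ≤
      FoldPerfection.morsePerfection (m + 1) M :=
  mainTheorem1_general m M
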